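/- Let $n,m\ge 1$ be integers, $0<\alpha<n/m$, and let $\xi(\mathbf t)$, $\mathbf t\in\mathbb R^n$, be a (jointly) measurable, mean-square continuous, homogeneous isotropic real Gaussian random field with $\mathbb E\,\xi(\mathbf t)=0$, $\mathbb E\,\xi(\mathbf t)^2=1$ and $\mathbb E\,\xi(\mathbf s)\xi(\mathbf t)=\|\mathbf s-\mathbf t\|^{-\alpha}L(\|\mathbf s-\mathbf t\|)$ for $\mathbf s\ne\mathbf t$, where $L:(0,\infty)\to(0,\infty)$ is measurable and slowly varying at infinity, i.e. $L(tr)/L(r)\to1$ as $r\to\infty$ for every $t>0$. Let $H_m(x)=(-1)^m e^{x^2/2}\frac{d^m}{dx^m}e^{-x^2/2}$ and $\mathbf 1_n=(1,\dots,1)\in\mathbb R^n$. Let $g:\mathbb R^n\to\mathbb R$ be Riemann integrable on every cube $[0,R]^n$ and such that $T^{2n-\alpha m}g^2(T\mathbf 1_n)L^m(T)\to\infty$ as $T\to\infty$ and, for some function $g^*$, $g(T\mathbf t)/g(T\mathbf 1_n)\to g^*(\mathbf t)$ as $T\to\infty$ uniformly in $\mathbf t\in[0,1]^n$. Then for all $T_1,\dots,T_n$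 the integral $\int_{\prod_{l=1}^n[0,T_l]}g(\mathbf t)H_m(\xi(\mathbf t))\,d\mathbf t$ exists almost surely and the difference below is square integrable. If $T_1,\dots,T_n\ge0$ vary so that $\tilde T=\max(T_1,\dots,T_n)\to\infty$ and the limits $\lim T_l/\tilde T$, $l=1,\dots,n$, exist, then $$\lim_{\tilde T\to\infty}\frac{\mathbb E\Big[\int_{\prod_{l=1}^n[0,T_l]}g(\mathbf t)H_m(\xi(\mathbf t))\,d\mathbf t-\sum_{i_1=0}^{[T_1]-1}\cdots\sum_{i_n=0}^{[T_n]-1}g(\mathbf i)H_m(\xi(\mathbf i))\Big]^2}{\tilde T^{2n-\alpha m}\,g^2(\tilde T\mathbf 1_n)\,L^m(\tilde T)}=0,\qquad \mathbf i=(i_1,\dots,i_n).$$ -/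

import Mathlib

open MeasureTheory ProbabilityTheory Filter Topology

/-- `L : (0,∞) → (0,∞)` is measurable and slowly varying at infinity
(only the values of `L` at positive arguments matter). -/
structure IsSlowlyVarying (L : ℝ → ℝ) : Prop where
  pos : ∀ r : ℝ, 0 < r → 0 < L r
  measurable : Measurable (fun r : Set.Ioi (0 : ℝ) => L r)
  tendsto_ratio : ∀ t : ℝ, 0 < t → Tendsto (fun r : ℝ => L (t * r) / L r) atTop (𝓝 1)

/-- `ξ` is a measurable, mean-square continuous, homogeneous isotropic Gaussian random field on
`ℝⁿ` with mean zero and unit variance, whose covariance is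
`E ξ(x) ξ(y) = ‖x - y‖ ^ (-α) * L ‖x - y‖` for `x ≠ y`. As the field is Gaussian and centred,
homogeneity and isotropy say that the covariance depends on `‖x - y‖` only. -/
structure IsLongRangeGaussianField {n : ℕ} {Ω : Type*} [MeasurableSpace Ω] (P : Measure Ω)
    (ξ : EuclideanSpace ℝ (Fin n) → Ω → ℝ) (α : ℝ) (L : ℝ → ℝ) : Prop where
  measurable : Measurable (Function.uncurry ξ)
  gaussian : IsGaussianProcess ξ P
  meanSquareContinuous : ∀ x, Tendsto (fun y => ∫ ω, (ξ y ω - ξ x ω) ^ 2 ∂P) (𝓝 x) (𝓝 0)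
  mean_zero : ∀ x, ∫ ω, ξ x ω ∂P = 0
  variance_one : ∀ x, ∫ ω, ξ x ω * ξ x ω ∂P = 1
  covariance : ∀ x y, x ≠ y → ∫ ω, ξ x ω * ξ y ω ∂P = ‖x - y‖ ^ (-α) * L ‖x - y‖
  slowlyVarying : IsSlowlyVarying L

/-- The box `∏ᵢ [0, Tᵢ]` in `ℝⁿ`. -/
def originBox {n : ℕ} (T : Fin n → ℝ) : Set (EuclideanSpace ℝ (Fin n)) :=
  {t | ∀ i, t i ∈ Set.Icc 0 (T i)}

/-- The diagonal point `T·1ₙ = (T, …, T)`. -/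
def diagPoint (n : ℕ) (T : ℝ) : EuclideanSpace ℝ (Fin n) :=
  WithLp.toLp 2 (fun _ => T)

/-- The lattice point `(i₁, …, iₙ)` as a point of `ℝⁿ`. -/
def latticePoint {n : ℕ} (i : Fin n → ℕ) : EuclideanSpace ℝ (Fin n) :=
  WithLp.toLp 2 (fun l => (i l : ℝ))

/-- `g` is Riemann integrable on every cube `[0, R]ⁿ`: it is bounded on the cube, and almost every
point of the cube is a point of continuity (Lebesgue's criterion). -/
def IsRiemannIntegrableOnCubes {n : ℕ} (g : EuclideanSpace ℝ (Fin n) → ℝ) : Prop :=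
  ∀ R : ℝ, (∃ C : ℝ, ∀ t ∈ originBox (fun _ : Fin n => R), |g t| ≤ C) ∧
    ∀ᵐ t ∂(volume.restrict (originBox (fun _ : Fin n => R))),
      ContinuousWithinAt g (originBox (fun _ : Fin n => R)) t

/-- The condition on the weight function: `T^(2n - mα) g²(T·1ₙ) Lᵐ(T) → ∞`, and
`g(T t) / g(T·1ₙ)` converges, uniformly in `t ∈ [0,1]ⁿ`, as `T → ∞`. -/
structure IsAdmissibleWeight {n : ℕ} (g : EuclideanSpace ℝ (Fin n) → ℝ) (m : ℕ) (α : ℝ)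
    (L : ℝ → ℝ) : Prop where
  normalization : Tendsto
    (fun T : ℝ => T ^ (2 * (n : ℝ) - m * α) * g (diagPoint n T) ^ 2 * L T ^ m) atTop atTop
  exists_limit : ∃ gstar : EuclideanSpace ℝ (Fin n) → ℝ,
    TendstoUniformlyOn (fun (T : ℝ) t => g (T • t) / g (diagPoint n T)) gstar atTop
      (originBox (fun _ : Fin n => 1))

/-- The `m`-th (probabilists') Hermite polynomial
`H_m(x) = (-1)^m exp(x²/2) (d/dx)^m exp(-x²/2)` as a real function. -/
noncomputable def hermiteFun (m : ℕ) (x : ℝ) : ℝ :=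
  Polynomial.aeval x (Polynomial.hermite m)

/-- The random variable `∫_{∏[0,Tᵢ]} g(t) H_m(ξ(t)) dt`. -/
noncomputable def integralFunctional {n : ℕ} {Ω : Type*} (g : EuclideanSpace ℝ (Fin n) → ℝ)
    (m : ℕ) (ξ : EuclideanSpace ℝ (Fin n) → Ω → ℝ) (T : Fin n → ℝ) (ω : Ω) : ℝ :=
  ∫ t in originBox T, g t * hermiteFun m (ξ t ω)

/-- The random variable `∑_{i₁=0}^{[T₁]-1} ⋯ ∑_{iₙ=0}^{[Tₙ]-1} g(i) H_m(ξ(i))`. -/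
noncomputable def additiveFunctional {n : ℕ} {Ω : Type*} (g : EuclideanSpace ℝ (Fin n) → ℝ)
    (m : ℕ) (ξ : EuclideanSpace ℝ (Fin n) → Ω → ℝ) (T : Fin n → ℝ) (ω : Ω) : ℝ :=
  ∑ i ∈ Fintype.piFinset (fun l => Finset.range ⌊T l⌋₊),
    g (latticePoint i) * hermiteFun m (ξ (latticePoint i) ω)

/-!
The difference of the two functionals is written as one integral. A lattice sum is the integral of
a step function over `∏ [0, ⌊Tᵢ⌋)` (`sum_latticePoint_eq_setIntegral`), so after rescaling by
`τ = maxᵢ Tᵢ` the difference becomes `τ ^ n g(τ·1)` times the integral over the unit cube of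
`a(u) H_m(ξ(τ u)) - b(u) H_m(ξ(⌊τ u⌋))`, where `a` and `b` are `g(τ u) / g(τ·1)` and
`g(⌊τ u⌋) / g(τ·1)`, cut off to the respective boxes
(`IsLongRangeGaussianField.ae_functional_sub_eq`).

For jointly Gaussian standard variables `E H_m(X) H_m(Y) = m! (E X Y) ^ m`
(`integral_hermiteFun_mul_hermiteFun`). By Fubini the second moment of the difference is therefore a
double integral over the unit cube of four terms with alternating signs (`covKernel`), each a
product of two weights and a power of the correlation `B(r) = r ^ (-α) L(r)`
(`IsLongRangeGaussianField.integral_functional_sub_sq`). The normalization in the theorem is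
`τ ^ (2n) g(τ·1)² B(τ) ^ m`. After division by it, all four terms converge almost everywhere to the
same limit, because

* both weights converge to the limit weight `g*` cut off to the limit box; `g*` is almost everywhere
  continuous as a uniform limit of almost everywhere continuous functions, so replacing `u` by
  `⌊τ u⌋ / τ` is harmless;
* `B(τ c_τ) / B(τ) → c ^ (-α)` whenever `c_τ → c > 0`. This is the uniform convergence theorem for
  slowly varying functions. Mean-square continuity makes `L` continuous, and then it follows from
  the Baire category theorem (`exists_uniform_increment_bound`).

Thus the four limits cancel. Dominated convergence applies because, for large `τ`, Potter's bound
(`exists_radialCorr_bound`) dominates every term by a constant times `‖u - v‖ ^ (-β)` with `β < n`,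
which is integrable on the square of the unit cube (`integrable_norm_sub_rpow`).
-/

/-! ### Hermite polynomials of Gaussian variables -/

lemma integrable_eval_gaussianReal (p : Polynomial ℝ) (v : NNReal) :
    Integrable (fun x => p.eval x) (gaussianReal 0 v) := by
  simp_rw [Polynomial.eval_eq_sum_range]
  refine integrable_finsetSum _ fun i _ => Integrable.const_mul ?_ _
  rcases Nat.eq_zero_or_pos i with rfl | hi
  · simp
  · have h := (memLp_id_gaussianReal (μ := 0) (v := v) (i : NNReal)).integrable_norm_pow (p := i)
      hi.ne'
    refine (integrable_norm_iff (by fun_prop)).1 (h.congr ?_)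
    exact .of_forall fun x => by simp

/-- Gaussian integration by parts for polynomials. -/
lemma integral_mul_eval_gaussianReal (p : Polynomial ℝ) :
    ∫ x, x * p.eval x ∂gaussianReal 0 1 = ∫ x, p.derivative.eval x ∂gaussianReal 0 1 := by
  have hderiv : ∀ x, HasDerivAt (fun x => gaussianPDFReal 0 1 x * p.eval x)
      (gaussianPDFReal 0 1 x * (p.derivative - Polynomial.X * p).eval x) x := by
    intro x
    have h1 : HasDerivAt (gaussianPDFReal 0 1) (-x * gaussianPDFReal 0 1 x) x := by
      have h : HasDerivAt (fun x : ℝ => -(x - 0) ^ 2 / (2 * ((1 : NNReal) : ℝ))) (-x) x := by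
        have := (((hasDerivAt_id x).sub_const 0).pow 2).neg.div_const (2 * ((1 : NNReal) : ℝ))
        refine this.congr_deriv ?_
        simp
        ring
      have h' := (h.exp).const_mul (√(2 * Real.pi * ((1 : NNReal) : ℝ)))⁻¹
      refine h'.congr_deriv ?_
      rw [gaussianPDFReal_def]; ring
    refine (h1.mul (p.hasDerivAt x)).congr_deriv ?_
    simp; ring
  have hint : ∀ q : Polynomial ℝ, Integrable (fun x => gaussianPDFReal 0 1 x * q.eval x) := by
    intro q
    have h := integrable_eval_gaussianReal q 1
    rw [gaussianReal_of_var_ne_zero _ one_ne_zero,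
      integrable_withDensity_iff_integrable_smul' (measurable_gaussianPDF _ _)
        (.of_forall fun _ => gaussianPDF_lt_top)] at h
    simpa using h
  have h0 := integral_eq_zero_of_hasDerivAt_of_integrable hderiv (hint _) (hint _)
  have h1 : ∫ x, (p.derivative - Polynomial.X * p).eval x ∂gaussianReal 0 1 = 0 := by
    rw [integral_gaussianReal_eq_integral_smul one_ne_zero]; simpa using h0
  simp only [Polynomial.eval_sub] at h1
  rw [integral_sub (integrable_eval_gaussianReal _ _) (integrable_eval_gaussianReal _ _)] at h1
  simp only [Polynomial.eval_mul, Polynomial.eval_X] at h1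
  linarith

lemma hermiteFun_eq_eval (m : ℕ) (x : ℝ) :
    hermiteFun m x = ((Polynomial.hermite m).map (Int.castRingHom ℝ)).eval x := by
  simp [hermiteFun, Polynomial.aeval_def, Polynomial.eval₂_eq_eval_map]

/-- Pairing with `H_m` under the standard Gaussian measure differentiates `m` times. -/
lemma integral_hermiteFun_mul_eval (m : ℕ) (p : Polynomial ℝ) :
    ∫ x, hermiteFun m x * p.eval x ∂gaussianReal 0 1
      = ∫ x, (Polynomial.derivative^[m] p).eval x ∂gaussianReal 0 1 := by
  induction m generalizing p with
  | zero => simp [hermiteFun]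
  | succ m ih =>
    set H := (Polynomial.hermite m).map (Int.castRingHom ℝ) with hH
    have h1 : ∀ x, hermiteFun (m + 1) x * p.eval x
        = x * (H * p).eval x - (H.derivative * p).eval x := by
      intro x
      rw [hermiteFun_eq_eval, Polynomial.hermite_succ]
      simp [hH, Polynomial.derivative_map]
      ring
    simp_rw [h1]
    have hi : Integrable (fun x => x * (H * p).eval x) (gaussianReal 0 1) := by
      refine (integrable_eval_gaussianReal (Polynomial.X * (H * p)) 1).congr
        (.of_forall fun x => ?_)
      simp
    rw [integral_sub hi (integrable_eval_gaussianReal _ _), integral_mul_eval_gaussianReal,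
      ← integral_sub (integrable_eval_gaussianReal _ _) (integrable_eval_gaussianReal _ _),
      Function.iterate_succ_apply, ← ih]
    refine integral_congr_ae (.of_forall fun x => ?_)
    simp [hermiteFun_eq_eval, hH]

/-- The shifted pairing `∫ H_m(x) H_m(r x + z) dγ(x) = m! r ^ m` does not depend on `z`, because
the `m`-th derivative of `H_m(r x + z)` in `x` is the constant `m! r ^ m`. -/
lemma integral_hermiteFun_mul_hermiteFun_affine (m : ℕ) (r z : ℝ) :
    ∫ x, hermiteFun m x * hermiteFun m (r * x + z) ∂gaussianReal 0 1
      = (m.factorial : ℝ) * r ^ m := by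
  set p := (Polynomial.hermite m).map (Int.castRingHom ℝ) with hp
  set q : Polynomial ℝ := Polynomial.C r * Polynomial.X + Polynomial.C z with hq
  have hiter : ∀ k, ∀ s : Polynomial ℝ, Polynomial.derivative^[k] (s.comp q)
      = Polynomial.C (r ^ k) * (Polynomial.derivative^[k] s).comp q := by
    intro k
    induction k with
    | zero => simp
    | succ k ih =>
      intro s
      rw [Function.iterate_succ_apply', ih, Function.iterate_succ_apply' _ k s]
      rw [Polynomial.derivative_C_mul, Polynomial.derivative_comp, pow_succ, Polynomial.C_mul]
      simp only [hq, Polynomial.derivative_add, Polynomial.derivative_C_mul,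
        Polynomial.derivative_X, Polynomial.derivative_C]
      ring
  have hdm : Polynomial.derivative^[m] p = Polynomial.C (m.factorial : ℝ) := by
    have h0 : (Polynomial.derivative^[m] p).natDegree = 0 := by
      have := Polynomial.natDegree_iterate_derivative p m
      rw [hp, (Polynomial.hermite_monic m).natDegree_map, Polynomial.natDegree_hermite] at this
      rw [hp]; omega
    rw [Polynomial.eq_C_of_natDegree_eq_zero h0, Polynomial.coeff_iterate_derivative]
    simp [hp, Polynomial.coeff_hermite_self, Nat.descFactorial_self]
  have h1 : ∀ x, hermiteFun m x * hermiteFun m (r * x + z)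
      = hermiteFun m x * (p.comp q).eval x := by
    intro x
    rw [hermiteFun_eq_eval m (r * x + z)]
    simp [hq, hp]
  simp_rw [h1]
  rw [integral_hermiteFun_mul_eval, hiter, hdm]
  simp [mul_comm]

lemma continuous_hermiteFun (m : ℕ) : Continuous (hermiteFun m) := by
  simp_rw [funext (hermiteFun_eq_eval m)]
  exact Polynomial.continuous _

section GaussianVariables

variable {Ω : Type*} [MeasurableSpace Ω] {P : Measure Ω}

lemma integrable_eval_of_hasGaussianLaw {X : Ω → ℝ} (hX : HasGaussianLaw X P)
    (h0 : ∫ ω, X ω ∂P = 0) (p : Polynomial ℝ) : Integrable (fun ω => p.eval (X ω)) P := by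
  have h := hX.map_eq_gaussianReal
  rw [h0] at h
  have h' := integrable_eval_gaussianReal p (Var[X; P].toNNReal)
  rw [← h] at h'
  exact h'.comp_aemeasurable hX.aemeasurable

lemma memLp_hermiteFun_comp {X : Ω → ℝ} (hX : HasGaussianLaw X P) (h0 : ∫ ω, X ω ∂P = 0) (m : ℕ) :
    MemLp (fun ω => hermiteFun m (X ω)) 2 P := by
  refine (memLp_two_iff_integrable_sq
    ((continuous_hermiteFun m).comp_aestronglyMeasurable hX.aemeasurable.aestronglyMeasurable)).2 ?_
  refine (integrable_eval_of_hasGaussianLaw hX h0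
    (((Polynomial.hermite m).map (Int.castRingHom ℝ)) ^ 2)).congr (.of_forall fun ω => ?_)
  simp [hermiteFun_eq_eval]

/-- Orthogonality of Hermite polynomials along correlated Gaussians:
`E H_m(X) H_m(Y) = m! (E X Y) ^ m` for jointly Gaussian standard `X`, `Y`. The proof writes
`Y = r X + Z` with `Z` independent of `X`, which also covers the degenerate cases `r = ± 1`. -/
lemma integral_hermiteFun_mul_hermiteFun {X Y : Ω → ℝ}
    (hXY : HasGaussianLaw (fun ω => (X ω, Y ω)) P) (hX0 : ∫ ω, X ω ∂P = 0)
    (hY0 : ∫ ω, Y ω ∂P = 0) (hX1 : ∫ ω, X ω * X ω ∂P = 1) (m : ℕ) :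
    ∫ ω, hermiteFun m (X ω) * hermiteFun m (Y ω) ∂P
      = (m.factorial : ℝ) * (∫ ω, X ω * Y ω ∂P) ^ m := by
  have := hXY.isProbabilityMeasure
  set r := ∫ ω, X ω * Y ω ∂P with hr
  set Z : Ω → ℝ := fun ω => Y ω - r * X ω with hZ
  have hX := hXY.fst
  have hY := hXY.snd
  have hXZ : HasGaussianLaw (fun ω => (X ω, Z ω)) P := by
    have := hXY.map_fun ((ContinuousLinearMap.fst ℝ ℝ ℝ).prod
      (ContinuousLinearMap.snd ℝ ℝ ℝ - r • ContinuousLinearMap.fst ℝ ℝ ℝ))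
    simpa [hZ] using this
  have hXm : MemLp X 2 P := hX.memLp_two
  have hYm : MemLp Y 2 P := hY.memLp_two
  have hind : IndepFun X Z P := by
    refine hXZ.indepFun_of_covariance_eq_zero ?_
    rw [covariance_eq_sub hXm hXZ.snd.memLp_two]
    have e : ∀ ω, (X * Z) ω = X ω * Y ω - r * (X ω * X ω) := fun ω => by
      simp [hZ]; ring
    simp_rw [e]
    have i1 : Integrable (fun ω => X ω * Y ω) P := hXm.integrable_mul hYm
    have i2 : Integrable (fun ω => X ω * X ω) P := hXm.integrable_mul hXm
    rw [integral_sub i1 (i2.const_mul r), integral_const_mul, hX1, hX0]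
    simp [hr]
  have hlaw := (indepFun_iff_map_prod_eq_prod_map_map hX.aemeasurable hXZ.snd.aemeasurable).1 hind
  have hXlaw : P.map X = gaussianReal 0 1 := by
    rw [hX.map_eq_gaussianReal, hX0, variance_of_integral_eq_zero hX.aemeasurable hX0]
    simp only [sq, hX1, Real.toNNReal_one]
  set F : ℝ × ℝ → ℝ := fun q => hermiteFun m q.1 * hermiteFun m (r * q.1 + q.2) with hF
  have hFc : Continuous F := by
    have := continuous_hermiteFun m
    fun_prop
  have e1 : ∀ ω, hermiteFun m (X ω) * hermiteFun m (Y ω) = F (X ω, Z ω) := fun ω => by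
    simp [hF, hZ]
  have hFint : Integrable (fun ω => F (X ω, Z ω)) P := by
    simp_rw [← e1]
    exact (memLp_hermiteFun_comp hX hX0 m).integrable_mul (memLp_hermiteFun_comp hY hY0 m)
  simp_rw [e1]
  rw [← integral_map (φ := fun ω => (X ω, Z ω)) hXZ.aemeasurable
    hFc.aestronglyMeasurable, hlaw, integral_prod_symm, hXlaw]
  · have := Measure.isProbabilityMeasure_map (μ := P) hXZ.snd.aemeasurable
    simp_rw [hF, integral_hermiteFun_mul_hermiteFun_affine]
    simp
  · rw [← hlaw]
    exact (integrable_map_measure hFc.aestronglyMeasurable hXZ.aemeasurable).2 hFint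

end GaussianVariables

/-! ### Slowly varying functions and the correlation of the field -/

/-- Local uniformity in the slow variation property (additive form), by the Baire category
theorem: the closed sets of those `u` for which `|h (x + u) - h x| ≤ ε / 2` for all `x ≥ N` cover
the line, so one of them contains an interval. -/
lemma exists_uniform_increment_bound {h : ℝ → ℝ} (hc : Continuous h)
    (hlim : ∀ u, Tendsto (fun x => h (x + u) - h x) atTop (𝓝 0)) {ε : ℝ} (hε : 0 < ε) :
    ∃ δ > 0, ∃ N : ℝ, ∀ y ≥ N, ∀ v, 0 ≤ v → v ≤ δ → |h (y + v) - h y| ≤ ε := by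
  let A : ℕ → Set ℝ := fun N => {u | ∀ x : ℝ, (N : ℝ) ≤ x → |h (x + u) - h x| ≤ ε / 2}
  have hA : ∀ N, IsClosed (A N) := by
    intro N
    simp only [A, Set.ofPred_forall]
    exact isClosed_iInter fun x => isClosed_iInter fun _ =>
      isClosed_le (by fun_prop) continuous_const
  have hU : ⋃ N, A N = Set.univ := by
    refine Set.eq_univ_of_forall fun u => Set.mem_iUnion.2 ?_
    have h1 := (hlim u).abs.eventually_lt_const (u := ε / 2) (by simpa using hε)
    obtain ⟨a, ha⟩ := eventually_atTop.1 h1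
    obtain ⟨N, hN⟩ := exists_nat_ge a
    exact ⟨N, fun x hx => (ha x (hN.trans hx)).le⟩
  obtain ⟨N, u, hu⟩ := nonempty_interior_of_iUnion_of_closed hA hU
  obtain ⟨δ, hδ, hball⟩ := Metric.isOpen_iff.1 isOpen_interior u hu
  refine ⟨δ / 2, by positivity, N + u, fun y hy v hv0 hv => ?_⟩
  have hv' : u + v ∈ A N := interior_subset (hball (by
    rw [Metric.mem_ball, Real.dist_eq]; simp [abs_of_nonneg hv0]; linarith))
  have h1 := hv' (y - u) (by linarith)
  have h2 := interior_subset hu (y - u) (by linarith)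
  rw [show y - u + (u + v) = y + v by ring] at h1
  rw [show y - u + u = y by ring] at h2
  rw [abs_le] at *
  constructor <;> linarith [h1.1, h1.2, h2.1, h2.2]

lemma tendsto_increment_of_tendsto {h : ℝ → ℝ} (hc : Continuous h)
    (hlim : ∀ u, Tendsto (fun x => h (x + u) - h x) atTop (𝓝 0))
    {ι : Type*} {l : Filter ι} {x v : ι → ℝ} {u : ℝ} (hx : Tendsto x l atTop)
    (hv : Tendsto v l (𝓝 u)) : Tendsto (fun s => h (x s + v s) - h (x s)) l (𝓝 0) := by
  rw [Metric.tendsto_nhds]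
  intro ε hε
  obtain ⟨δ, hδ, N, hN⟩ := exists_uniform_increment_bound hc hlim (show 0 < ε / 2 by positivity)
  have h1 := Metric.tendsto_nhds.1 ((hlim u).comp hx) (ε / 2) (by positivity)
  have h2 := Metric.tendsto_nhds.1 hv δ hδ
  have h3 := hx.eventually_ge_atTop (N - u + δ)
  filter_upwards [h1, h2, h3] with s h1 h2 h3
  simp only [Real.dist_eq, sub_zero, Function.comp] at *
  have h4 : |h (x s + v s) - h (x s + u)| ≤ ε / 2 := by
    rw [abs_lt] at h2
    rcases le_total u (v s) with huv | huv
    · have := hN (x s + u) (by linarith) (v s - u) (by linarith) (by linarith)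
      rwa [show x s + u + (v s - u) = x s + v s by ring] at this
    · have := hN (x s + v s) (by linarith) (u - v s) (by linarith) (by linarith)
      rwa [show x s + v s + (u - v s) = x s + u by ring, abs_sub_comm] at this
  calc |h (x s + v s) - h (x s)|
      = |(h (x s + v s) - h (x s + u)) + (h (x s + u) - h (x s))| := by ring_nf
    _ ≤ _ := abs_add_le _ _
    _ < ε := by linarith

lemma increment_bound_iterate {h : ℝ → ℝ} {δ c N : ℝ} (hδ : 0 ≤ δ)
    (hN : ∀ y ≥ N, ∀ v, 0 ≤ v → v ≤ δ → |h (y + v) - h y| ≤ c) (k : ℕ) :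
    ∀ y ≥ N, ∀ v, 0 ≤ v → v ≤ k * δ → |h (y + v) - h y| ≤ k * c := by
  induction k with
  | zero =>
    intro y _ v hv hv'
    obtain rfl : v = 0 := le_antisymm (by simpa using hv') hv
    simp
  | succ k ih =>
    intro y hy v hv hv'
    push_cast at *
    have h1 := hN y hy (min v δ) (le_min hv hδ) (min_le_right _ _)
    have h2 := ih (y + min v δ) (by linarith [le_min hv hδ]) (v - min v δ)
      (by linarith [min_le_left v δ]) (by
        rcases le_total v δ with h | h
        · rw [min_eq_left h, sub_self]; positivity
        · rw [min_eq_right h]; linarith)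
    rw [show y + min v δ + (v - min v δ) = y + v by ring] at h2
    rw [abs_le] at *
    constructor <;> linarith [h1.1, h1.2, h2.1, h2.2]

/-- Additive form of Potter's bound. -/
lemma exists_linear_increment_bound {h : ℝ → ℝ} (hc : Continuous h)
    (hlim : ∀ u, Tendsto (fun x => h (x + u) - h x) atTop (𝓝 0)) {ε : ℝ} (hε : 0 < ε) :
    ∃ C N : ℝ, ∀ y ≥ N, ∀ v, 0 ≤ v → |h (y + v) - h y| ≤ ε * v + C := by
  obtain ⟨δ, hδ, N₀, hN₀⟩ := exists_uniform_increment_bound hc hlim one_pos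
  obtain ⟨K, hK⟩ := exists_nat_ge (1 / δ)
  have hK' : 1 ≤ K * δ := by rwa [div_le_iff₀ hδ] at hK
  have hunit := increment_bound_iterate hδ.le hN₀ K
  obtain ⟨N₁, hN₁⟩ := eventually_atTop.1
    ((hlim 1).abs.eventually_lt_const (u := ε) (by simpa using hε))
  have hint : ∀ k : ℕ, ∀ y ≥ N₁, |h (y + k) - h y| ≤ k * ε := by
    intro k
    induction k with
    | zero => simp
    | succ k ih =>
      intro y hy
      have h1 := ih y hy
      have h2 := (hN₁ (y + k) (by have := k.cast_nonneg (α := ℝ); linarith)).le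
      push_cast
      rw [show y + (k + 1 : ℝ) = y + k + 1 by ring]
      rw [abs_le] at *
      constructor <;> linarith [h1.1, h1.2, h2.1, h2.2]
  -- the integer part of `v` costs `ε` per unit step, the fractional part at most `K`
  refine ⟨K * 1, max N₀ N₁, fun y hy v hv => ?_⟩
  have hf := Nat.floor_le hv
  have hf' := Nat.lt_floor_add_one v
  have h1 := hint ⌊v⌋₊ y (le_trans (le_max_right _ _) hy)
  have h2 := hunit (y + ⌊v⌋₊)
    (by have := (⌊v⌋₊).cast_nonneg (α := ℝ); linarith [le_trans (le_max_left _ _) hy])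
    (v - ⌊v⌋₊) (by linarith) (by linarith)
  rw [show y + ⌊v⌋₊ + (v - ⌊v⌋₊) = y + v by ring] at h2
  have h3 : (⌊v⌋₊ : ℝ) * ε ≤ ε * v := by nlinarith
  rw [abs_le] at *
  constructor <;> linarith [h1.1, h1.2, h2.1, h2.2]

namespace IsSlowlyVarying

variable {L : ℝ → ℝ}

lemma continuous_log_comp_exp (hL : IsSlowlyVarying L) (hc : ContinuousOn L (Set.Ioi 0)) :
    Continuous fun x => Real.log (L (Real.exp x)) :=
  Continuous.log (hc.comp_continuous Real.continuous_exp fun x => Real.exp_pos x)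
    fun x => (hL.pos _ (Real.exp_pos x)).ne'

lemma tendsto_log_increment (hL : IsSlowlyVarying L) (u : ℝ) :
    Tendsto (fun x => Real.log (L (Real.exp (x + u))) - Real.log (L (Real.exp x))) atTop
      (𝓝 0) := by
  have h1 := ((hL.tendsto_ratio (Real.exp u) (Real.exp_pos u)).comp
    Real.tendsto_exp_atTop).log one_ne_zero
  rw [Real.log_one] at h1
  refine h1.congr fun x => ?_
  simp only [Function.comp]
  rw [Real.log_div (hL.pos _ (by positivity)).ne' (hL.pos _ (by positivity)).ne', Real.exp_add,
    mul_comm]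

/-- Uniform convergence theorem for continuous slowly varying functions, in terms of a moving
multiplier. -/
lemma tendsto_ratio_of_tendsto (hL : IsSlowlyVarying L) (hc : ContinuousOn L (Set.Ioi 0))
    {ι : Type*} {l : Filter ι} {T c : ι → ℝ} {c₀ : ℝ} (hT : Tendsto T l atTop) (hc₀ : 0 < c₀)
    (hcl : Tendsto c l (𝓝 c₀)) : Tendsto (fun s => L (T s * c s) / L (T s)) l (𝓝 1) := by
  have h := tendsto_increment_of_tendsto (hL.continuous_log_comp_exp hc) hL.tendsto_log_increment
    (Real.tendsto_log_atTop.comp hT) (hcl.log hc₀.ne')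
  have h' := (Real.continuous_exp.tendsto 0).comp h
  rw [Real.exp_zero] at h'
  refine h'.congr' ?_
  filter_upwards [hT.eventually_gt_atTop 0, hcl.eventually_const_lt hc₀] with s h1 h2
  simp only [Function.comp]
  rw [Real.exp_sub, Real.exp_add, Real.exp_log h1, Real.exp_log h2,
    Real.exp_log (hL.pos _ h1), Real.exp_log (hL.pos _ (by positivity))]

/-- Potter's bound for a continuous slowly varying function. -/
lemma exists_potter_bound (hL : IsSlowlyVarying L) (hc : ContinuousOn L (Set.Ioi 0)) {ε : ℝ}
    (hε : 0 < ε) : ∃ C > 0, ∃ X ≥ 1, ∀ r ≥ X, ∀ s ≥ r,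
      L r ≤ C * (s / r) ^ ε * L s ∧ L s ≤ C * (s / r) ^ ε * L r := by
  obtain ⟨C, N, hN⟩ := exists_linear_increment_bound (hL.continuous_log_comp_exp hc)
    hL.tendsto_log_increment hε
  refine ⟨Real.exp C, Real.exp_pos _, max 1 (Real.exp N), le_max_left _ _, fun r hr s hs => ?_⟩
  have hr0 : 0 < r := one_pos.trans_le ((le_max_left _ _).trans hr)
  have hs0 : 0 < s := hr0.trans_le hs
  have h := hN (Real.log r) ((Real.le_log_iff_exp_le hr0).2 ((le_max_right _ _).trans hr))
    (Real.log (s / r)) (Real.log_nonneg ((one_le_div hr0).2 hs))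
  rw [Real.log_div hs0.ne' hr0.ne',
    show Real.log r + (Real.log s - Real.log r) = Real.log s by ring,
    Real.exp_log hr0, Real.exp_log hs0, ← Real.log_div hs0.ne' hr0.ne'] at h
  have e : Real.exp C * (s / r) ^ ε = Real.exp (ε * Real.log (s / r) + C) := by
    rw [Real.rpow_def_of_pos (by positivity), ← Real.exp_add]; ring_nf
  rw [e]
  rw [abs_le] at h
  have hLr := hL.pos r hr0
  have hLs := hL.pos s hs0
  constructor
  · calc L r = Real.exp (Real.log (L r)) := (Real.exp_log hLr).symm
      _ ≤ Real.exp (ε * Real.log (s / r) + C + Real.log (L s)) :=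
          Real.exp_le_exp.2 (by linarith [h.1])
      _ = _ := by rw [Real.exp_add, Real.exp_log hLs]
  · calc L s = Real.exp (Real.log (L s)) := (Real.exp_log hLs).symm
      _ ≤ Real.exp (ε * Real.log (s / r) + C + Real.log (L r)) :=
          Real.exp_le_exp.2 (by linarith [h.2])
      _ = _ := by rw [Real.exp_add, Real.exp_log hLr]

end IsSlowlyVarying

/-- The correlation of the field at distance `r`: `r ^ (-α) * L r` for `r ≠ 0`, and `1` at `r = 0`,
where the formula `r ^ (-α) * L r` carries no information. -/
noncomputable def radialCorr (α : ℝ) (L : ℝ → ℝ) (r : ℝ) : ℝ :=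
  if r = 0 then 1 else r ^ (-α) * L r

section radialCorr

variable {α : ℝ} {L : ℝ → ℝ}

lemma radialCorr_of_pos {r : ℝ} (hr : 0 < r) : radialCorr α L r = r ^ (-α) * L r := by
  simp [radialCorr, hr.ne']

lemma radialCorr_pos (hL : IsSlowlyVarying L) {r : ℝ} (hr : 0 ≤ r) : 0 < radialCorr α L r := by
  rcases hr.eq_or_lt with rfl | hr
  · simp [radialCorr]
  · rw [radialCorr_of_pos hr]
    exact mul_pos (Real.rpow_pos_of_pos hr _) (hL.pos r hr)

lemma tendsto_radialCorr_ratio (hL : IsSlowlyVarying L) (hc : ContinuousOn L (Set.Ioi 0))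
    {ι : Type*} {l : Filter ι} {T c : ι → ℝ} {c₀ : ℝ} (hT : Tendsto T l atTop) (hc₀ : 0 < c₀)
    (hcl : Tendsto c l (𝓝 c₀)) :
    Tendsto (fun s => radialCorr α L (T s * c s) / radialCorr α L (T s)) l (𝓝 (c₀ ^ (-α))) := by
  have h1 := (hcl.rpow_const (p := -α) (Or.inl hc₀.ne')).mul
    (hL.tendsto_ratio_of_tendsto hc hT hc₀ hcl)
  rw [mul_one] at h1
  refine h1.congr' ?_
  filter_upwards [hT.eventually_gt_atTop 0, hcl.eventually_const_lt hc₀] with s h1 h2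
  rw [radialCorr_of_pos h1, radialCorr_of_pos (by positivity), Real.mul_rpow h1.le h2.le]
  have := Real.rpow_pos_of_pos h1 (-α)
  have := hL.pos _ h1
  field_simp

/-- Potter's bound for the correlation, extended down to distance zero. The `r + 1` in place of `r`
keeps the right-hand side finite at `r = 0` and makes it insensitive to bounded changes of `r`. -/
lemma exists_radialCorr_bound (hα : 0 < α) (hL : IsSlowlyVarying L)
    (hc : ContinuousOn L (Set.Ioi 0)) (hB : ∀ r, 0 ≤ r → radialCorr α L r ≤ 1) {ε D : ℝ}
    (hε : 0 < ε) (hD : 1 ≤ D) :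
    ∃ C > 0, ∃ X ≥ 1, ∀ T ≥ X, ∀ r, 0 ≤ r → r ≤ D * T →
      radialCorr α L r ≤ C * radialCorr α L T * (T / (r + 1)) ^ (α + ε) := by
  obtain ⟨C₀, hC₀, X, hX, hpot⟩ := hL.exists_potter_bound hc hε
  have hX0 : 0 < X := by linarith
  -- `C₁` serves `X ≤ r ≤ T`, `C₂` serves `T ≤ r ≤ D T`, and `C₃` serves `r < X`, where the bound
  -- `radialCorr ≤ 1` is compared with the value at `X`.
  set C₁ := C₀ * 2 ^ (α + ε) with hC₁
  set C₂ := C₀ * D ^ ε * (2 * D) ^ (α + ε) with hC₂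
  set C₃ := C₁ / radialCorr α L X with hC₃
  have hBX : 0 < radialCorr α L X := radialCorr_pos hL hX0.le
  have hC₁p : 0 < C₁ := by positivity
  have hC₂p : 0 < C₂ := by positivity
  have hC₃p : 0 < C₃ := by positivity
  have below : ∀ T r, X ≤ r → r ≤ T →
      radialCorr α L r ≤ C₁ * radialCorr α L T * (T / (r + 1)) ^ (α + ε) := by
    intro T r hr hrT
    have hr0 : 0 < r := by linarith
    have hT0 : 0 < T := by linarith
    rw [radialCorr_of_pos hr0, radialCorr_of_pos hT0]
    have h2 : T / r ≤ 2 * (T / (r + 1)) := by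
      rw [← mul_div_assoc, div_le_div_iff₀ hr0 (by linarith)]
      nlinarith
    calc r ^ (-α) * L r ≤ r ^ (-α) * (C₀ * (T / r) ^ ε * L T) := by
          gcongr
          exact (hpot r hr T hrT).1
      _ = C₀ * (T / r) ^ (α + ε) * (T ^ (-α) * L T) := by
          rw [Real.rpow_add (by positivity), Real.div_rpow hT0.le hr0.le α, Real.rpow_neg hr0.le,
            Real.rpow_neg hT0.le]
          have := Real.rpow_pos_of_pos hT0 α
          have := Real.rpow_pos_of_pos hr0 α
          field_simp
      _ ≤ C₀ * (2 * (T / (r + 1))) ^ (α + ε) * (T ^ (-α) * L T) := by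
          have := hL.pos T hT0
          gcongr
      _ = _ := by rw [Real.mul_rpow (by norm_num) (by positivity)]; ring
  refine ⟨C₁ + C₂ + C₃, by positivity, X, hX, fun T hT r hr hrT => ?_⟩
  have hT0 : 0 < T := by linarith
  have hBT : 0 < radialCorr α L T := radialCorr_pos hL hT0.le
  have hq : 0 < (T / (r + 1)) ^ (α + ε) := by positivity
  have key : ∀ C' ≤ C₁ + C₂ + C₃,
      radialCorr α L r ≤ C' * radialCorr α L T * (T / (r + 1)) ^ (α + ε) →
      radialCorr α L r ≤ (C₁ + C₂ + C₃) * radialCorr α L T * (T / (r + 1)) ^ (α + ε) :=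
    fun C' hC' h => h.trans (by gcongr)
  rcases lt_or_ge r X with hrX | hrX
  · refine key C₃ (by linarith) ?_
    calc radialCorr α L r ≤ 1 := hB r hr
      _ = (radialCorr α L X)⁻¹ * radialCorr α L X := by field_simp
      _ ≤ (radialCorr α L X)⁻¹ * (C₁ * radialCorr α L T * (T / (X + 1)) ^ (α + ε)) := by
          gcongr
          exact below T X le_rfl hT
      _ ≤ (radialCorr α L X)⁻¹ * (C₁ * radialCorr α L T * (T / (r + 1)) ^ (α + ε)) := by
          gcongr
      _ = _ := by rw [hC₃]; ring
  rcases le_total r T with h | h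
  · exact key C₁ (by linarith) (below T r hrX h)
  · refine key C₂ (by linarith) ?_
    have hr0 : 0 < r := by linarith
    have hLT := hL.pos T hT0
    have h1 : (1 : ℝ) ≤ (2 * D) ^ (α + ε) * (T / (r + 1)) ^ (α + ε) := by
      rw [← Real.mul_rpow (by positivity) (by positivity)]
      refine Real.one_le_rpow ?_ (by positivity)
      rw [← mul_div_assoc, one_le_div (by linarith)]
      linarith
    rw [radialCorr_of_pos hr0, radialCorr_of_pos hT0]
    calc r ^ (-α) * L r ≤ r ^ (-α) * (C₀ * (r / T) ^ ε * L T) := by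
          gcongr
          exact (hpot T hT r h).2
      _ ≤ T ^ (-α) * (C₀ * D ^ ε * L T) := by
          gcongr ?_ * (C₀ * ?_ * L T)
          · exact Real.rpow_le_rpow_of_nonpos hT0 h (by linarith)
          · exact Real.rpow_le_rpow (by positivity) ((div_le_iff₀ hT0).2 hrT) hε.le
      _ ≤ T ^ (-α) * (C₀ * D ^ ε * L T) * ((2 * D) ^ (α + ε) * (T / (r + 1)) ^ (α + ε)) :=
          le_mul_of_one_le_right (by positivity) h1
      _ = _ := by rw [hC₂]; ring

end radialCorr

/-- An isometric copy of the real line through the origin. -/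
lemma exists_norm_smul_sub_smul_eq {n : ℕ} (hn : 1 ≤ n) :
    ∃ e : EuclideanSpace ℝ (Fin n), ∀ r s : ℝ, ‖r • e - s • e‖ = |r - s| := by
  refine ⟨EuclideanSpace.single ⟨0, hn⟩ 1, fun r s => ?_⟩
  rw [← sub_smul, norm_smul]
  simp

namespace IsLongRangeGaussianField

variable {n : ℕ} {Ω : Type*} [MeasurableSpace Ω] {P : Measure Ω}
  {ξ : EuclideanSpace ℝ (Fin n) → Ω → ℝ} {α : ℝ} {L : ℝ → ℝ}

lemma memLp_two (hξ : IsLongRangeGaussianField P ξ α L) (x : EuclideanSpace ℝ (Fin n)) :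
    MemLp (ξ x) 2 P := (hξ.gaussian.hasGaussianLaw_eval x).memLp_two

lemma integrable_mul (hξ : IsLongRangeGaussianField P ξ α L) (x y : EuclideanSpace ℝ (Fin n)) :
    Integrable (fun ω => ξ x ω * ξ y ω) P := (hξ.memLp_two x).integrable_mul (hξ.memLp_two y)

lemma integral_mul_eq_radialCorr (hξ : IsLongRangeGaussianField P ξ α L)
    (x y : EuclideanSpace ℝ (Fin n)) :
    ∫ ω, ξ x ω * ξ y ω ∂P = radialCorr α L ‖x - y‖ := by
  rcases eq_or_ne x y with rfl | h
  · simp [radialCorr, hξ.variance_one]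
  · rw [hξ.covariance x y h, radialCorr_of_pos (norm_pos_iff.2 (sub_ne_zero.2 h))]

/-- The Cauchy–Schwarz inequality for an increment of the field. -/
lemma sq_integral_mul_sub_le (hξ : IsLongRangeGaussianField P ξ α L)
    (z x y : EuclideanSpace ℝ (Fin n)) :
    (∫ ω, ξ z ω * ξ y ω ∂P - ∫ ω, ξ z ω * ξ x ω ∂P) ^ 2 ≤ ∫ ω, (ξ y ω - ξ x ω) ^ 2 ∂P := by
  have hz := hξ.memLp_two z
  have hd : MemLp (fun ω => ξ y ω - ξ x ω) 2 P := (hξ.memLp_two y).sub (hξ.memLp_two x)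
  have hdz : Integrable (fun ω => ξ z ω * (ξ y ω - ξ x ω)) P := hz.integrable_mul hd
  rw [← integral_sub (hξ.integrable_mul z y) (hξ.integrable_mul z x)]
  set c := ∫ ω, (ξ z ω * ξ y ω - ξ z ω * ξ x ω) ∂P with hcdef
  have hc : ∫ ω, ξ z ω * (ξ y ω - ξ x ω) ∂P = c := by simp_rw [hcdef, mul_sub]
  -- expand `E (ξ_y - ξ_x - c ξ_z)² ≥ 0`
  have h0 : 0 ≤ ∫ ω, ((ξ y ω - ξ x ω) ^ 2 - 2 * c * (ξ z ω * (ξ y ω - ξ x ω))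
      + c ^ 2 * (ξ z ω * ξ z ω)) ∂P :=
    integral_nonneg fun ω => by
      have := sq_nonneg ((ξ y ω - ξ x ω) - c * ξ z ω)
      simp only [Pi.zero_apply]
      nlinarith
  have hs : Integrable (fun ω => (ξ y ω - ξ x ω) ^ 2 - 2 * c * (ξ z ω * (ξ y ω - ξ x ω))) P :=
    hd.integrable_sq.sub (hdz.const_mul _)
  rw [integral_add hs ((hξ.integrable_mul z z).const_mul _),
    integral_sub hd.integrable_sq (hdz.const_mul _), integral_const_mul, integral_const_mul,
    hξ.variance_one, hc] at h0
  nlinarith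

lemma radialCorr_norm_le_one (hξ : IsLongRangeGaussianField P ξ α L)
    (x y : EuclideanSpace ℝ (Fin n)) : radialCorr α L ‖x - y‖ ≤ 1 := by
  rw [← hξ.integral_mul_eq_radialCorr]
  have h : ∫ ω, ξ x ω * ξ y ω ∂P ≤ ∫ ω, (1 / 2 * (ξ x ω * ξ x ω) + 1 / 2 * (ξ y ω * ξ y ω)) ∂P := by
    refine integral_mono (hξ.integrable_mul x y)
      (((hξ.integrable_mul x x).const_mul _).add ((hξ.integrable_mul y y).const_mul _)) fun ω => ?_
    have := sq_nonneg (ξ x ω - ξ y ω)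
    simp only
    nlinarith
  rw [integral_add ((hξ.integrable_mul x x).const_mul _) ((hξ.integrable_mul y y).const_mul _),
    integral_const_mul, integral_const_mul, hξ.variance_one, hξ.variance_one] at h
  linarith

lemma radialCorr_le_one (hξ : IsLongRangeGaussianField P ξ α L) (hn : 1 ≤ n) {r : ℝ} (hr : 0 ≤ r) :
    radialCorr α L r ≤ 1 := by
  obtain ⟨e, he⟩ := exists_norm_smul_sub_smul_eq hn
  have h := hξ.radialCorr_norm_le_one (r • e) ((0 : ℝ) • e)
  rwa [he, sub_zero, abs_of_nonneg hr] at h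

/-- Mean-square continuity of the field makes `L` continuous. -/
lemma continuousOn_slowlyVarying (hξ : IsLongRangeGaussianField P ξ α L) (hn : 1 ≤ n) :
    ContinuousOn L (Set.Ioi 0) := by
  obtain ⟨e, he⟩ := exists_norm_smul_sub_smul_eq hn
  have hcont : Continuous fun r : ℝ => ∫ ω, ξ ((0 : ℝ) • e) ω * ξ (r • e) ω ∂P := by
    refine continuous_iff_continuousAt.2 fun r => ?_
    have h1 : Tendsto (fun s : ℝ => s • e) (𝓝 r) (𝓝 (r • e)) :=
      (continuous_id.smul continuous_const).tendsto r
    have h2 := ((hξ.meanSquareContinuous (r • e)).comp h1).sqrt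
    rw [Real.sqrt_zero] at h2
    refine tendsto_iff_norm_sub_tendsto_zero.2
      (squeeze_zero (fun _ => norm_nonneg _) (fun s => ?_) h2)
    rw [Real.norm_eq_abs]
    exact Real.abs_le_sqrt (hξ.sq_integral_mul_sub_le _ _ _)
  have h1 : ContinuousOn (fun r : ℝ => r ^ α * ∫ ω, ξ ((0 : ℝ) • e) ω * ξ (r • e) ω ∂P)
      (Set.Ioi 0) :=
    (continuousOn_id.rpow_const fun r hr => Or.inl (ne_of_gt hr)).mul hcont.continuousOn
  refine h1.congr fun r hr => ?_
  have hr : 0 < r := hr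
  simp only
  rw [hξ.integral_mul_eq_radialCorr, he, zero_sub, abs_neg, abs_of_pos hr, radialCorr_of_pos hr,
    ← mul_assoc, ← Real.rpow_add hr]
  simp

/-- Covariances of the Hermite-transformed field. -/
lemma integral_hermiteFun_mul (hξ : IsLongRangeGaussianField P ξ α L) (m : ℕ)
    (x y : EuclideanSpace ℝ (Fin n)) :
    ∫ ω, hermiteFun m (ξ x ω) * hermiteFun m (ξ y ω) ∂P
      = (m.factorial : ℝ) * radialCorr α L ‖x - y‖ ^ m := by
  rw [← hξ.integral_mul_eq_radialCorr]
  exact integral_hermiteFun_mul_hermiteFun hξ.gaussian.hasGaussianLaw_prodMk (hξ.mean_zero x)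
    (hξ.mean_zero y) (hξ.variance_one x) m

lemma memLp_hermiteFun (hξ : IsLongRangeGaussianField P ξ α L) (m : ℕ)
    (x : EuclideanSpace ℝ (Fin n)) : MemLp (fun ω => hermiteFun m (ξ x ω)) 2 P :=
  memLp_hermiteFun_comp (hξ.gaussian.hasGaussianLaw_eval x) (hξ.mean_zero x) m

end IsLongRangeGaussianField

/-! ### Second moments of integrals, lattice cells and weights -/

section SecondMoment

variable {S Ω : Type*} [MeasurableSpace S] [MeasurableSpace Ω] {μ : Measure S} [IsFiniteMeasure μ]
  {P : Measure Ω} [IsProbabilityMeasure P] {Z : S → Ω → ℝ} {C : ℝ}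

lemma aestronglyMeasurable_mul_pair
    (hZ : AEStronglyMeasurable (fun p : S × Ω => Z p.1 p.2) (μ.prod P)) :
    AEStronglyMeasurable (fun p : (S × S) × Ω => Z p.1.1 p.2 * Z p.1.2 p.2)
      ((μ.prod μ).prod P) := by
  have h1 : Measure.QuasiMeasurePreserving (Prod.map Prod.fst id : (S × S) × Ω → S × Ω)
      ((μ.prod μ).prod P) (μ.prod P) :=
    QuasiMeasurePreserving.prodMap Measure.quasiMeasurePreserving_fst
      (Measure.QuasiMeasurePreserving.id P)
  have h2 : Measure.QuasiMeasurePreserving (Prod.map Prod.snd id : (S × S) × Ω → S × Ω)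
      ((μ.prod μ).prod P) (μ.prod P) :=
    QuasiMeasurePreserving.prodMap Measure.quasiMeasurePreserving_snd
      (Measure.QuasiMeasurePreserving.id P)
  exact (hZ.comp_quasiMeasurePreserving h1).mul (hZ.comp_quasiMeasurePreserving h2)

lemma integrable_mul_pair
    (hZ : AEStronglyMeasurable (fun p : S × Ω => Z p.1 p.2) (μ.prod P))
    (hZ2 : ∀ s, MemLp (Z s) 2 P) (hC : ∀ s, ∫ ω, Z s ω ^ 2 ∂P ≤ C) :
    Integrable (fun p : (S × S) × Ω => Z p.1.1 p.2 * Z p.1.2 p.2) ((μ.prod μ).prod P) := by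
  have hm := aestronglyMeasurable_mul_pair hZ
  refine (integrable_prod_iff hm).2 ⟨.of_forall fun q => (hZ2 q.1).integrable_mul (hZ2 q.2), ?_⟩
  refine Integrable.of_bound hm.norm.integral_prod_right' C (.of_forall fun q => ?_)
  rw [Real.norm_of_nonneg (integral_nonneg fun _ => norm_nonneg _)]
  have h1 : ∫ ω, ‖Z q.1 ω * Z q.2 ω‖ ∂P ≤ ∫ ω, (1 / 2 * Z q.1 ω ^ 2 + 1 / 2 * Z q.2 ω ^ 2) ∂P := by
    refine integral_mono ((hZ2 q.1).integrable_mul (hZ2 q.2)).norm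
      (((hZ2 q.1).integrable_sq.const_mul _).add ((hZ2 q.2).integrable_sq.const_mul _)) fun ω => ?_
    simp only [Real.norm_eq_abs, abs_mul]
    nlinarith [sq_nonneg (|Z q.1 ω| - |Z q.2 ω|), sq_abs (Z q.1 ω), sq_abs (Z q.2 ω)]
  rw [integral_add ((hZ2 q.1).integrable_sq.const_mul _) ((hZ2 q.2).integrable_sq.const_mul _),
    integral_const_mul, integral_const_mul] at h1
  linarith [hC q.1, hC q.2]

lemma ae_integrable_of_secondMoment_le
    (hZ : AEStronglyMeasurable (fun p : S × Ω => Z p.1 p.2) (μ.prod P))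
    (hZ2 : ∀ s, MemLp (Z s) 2 P) (hC : ∀ s, ∫ ω, Z s ω ^ 2 ∂P ≤ C) :
    ∀ᵐ ω ∂P, Integrable (fun s => Z s ω) μ := by
  have hint : Integrable (fun p : S × Ω => Z p.1 p.2) (μ.prod P) := by
    refine (integrable_prod_iff hZ).2
      ⟨.of_forall fun s => (hZ2 s).integrable one_le_two, ?_⟩
    refine Integrable.of_bound hZ.norm.integral_prod_right' (1 + C) (.of_forall fun s => ?_)
    rw [Real.norm_of_nonneg (integral_nonneg fun _ => norm_nonneg _)]
    have h1 : ∫ ω, ‖Z s ω‖ ∂P ≤ ∫ ω, (1 + Z s ω ^ 2) ∂P := by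
      refine integral_mono ((hZ2 s).integrable one_le_two).norm
        ((integrable_const _).add (hZ2 s).integrable_sq) fun ω => ?_
      simp only [Real.norm_eq_abs]
      nlinarith [sq_nonneg (|Z s ω| - 1), sq_abs (Z s ω)]
    rw [integral_add (integrable_const _) (hZ2 s).integrable_sq] at h1
    simp only [integral_const, probReal_univ, smul_eq_mul, one_mul] at h1
    linarith [hC s]
  exact hint.prod_left_ae

lemma integrable_sq_integral
    (hZ : AEStronglyMeasurable (fun p : S × Ω => Z p.1 p.2) (μ.prod P))
    (hZ2 : ∀ s, MemLp (Z s) 2 P) (hC : ∀ s, ∫ ω, Z s ω ^ 2 ∂P ≤ C) :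
    Integrable (fun ω => (∫ s, Z s ω ∂μ) ^ 2) P := by
  refine (integrable_mul_pair hZ hZ2 hC).integral_prod_right.congr (.of_forall fun ω => ?_)
  simp only [sq]
  exact integral_prod_mul (fun s => Z s ω) fun s => Z s ω

lemma memLp_two_integral
    (hZ : AEStronglyMeasurable (fun p : S × Ω => Z p.1 p.2) (μ.prod P))
    (hZ2 : ∀ s, MemLp (Z s) 2 P) (hC : ∀ s, ∫ ω, Z s ω ^ 2 ∂P ≤ C) :
    MemLp (fun ω => ∫ s, Z s ω ∂μ) 2 P :=
  (memLp_two_iff_integrable_sq hZ.prod_swap.integral_prod_right').2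
    (integrable_sq_integral hZ hZ2 hC)

/-- The second moment of an integral is the double integral of the covariances. -/
lemma integral_sq_integral
    (hZ : AEStronglyMeasurable (fun p : S × Ω => Z p.1 p.2) (μ.prod P))
    (hZ2 : ∀ s, MemLp (Z s) 2 P) (hC : ∀ s, ∫ ω, Z s ω ^ 2 ∂P ≤ C) :
    ∫ ω, (∫ s, Z s ω ∂μ) ^ 2 ∂P = ∫ q, ∫ ω, Z q.1 ω * Z q.2 ω ∂P ∂μ.prod μ := by
  have h := integral_integral_swap
    (f := fun (q : S × S) ω => Z q.1 ω * Z q.2 ω) (integrable_mul_pair hZ hZ2 hC)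
  rw [h]
  refine integral_congr_ae (.of_forall fun ω => ?_)
  simp only [sq]
  exact (integral_prod_mul (fun s => Z s ω) fun s => Z s ω).symm

end SecondMoment

section Geometry

variable {n : ℕ}

lemma measurableSet_originBox (T : Fin n → ℝ) : MeasurableSet (originBox T) := by
  have : originBox T = ⋂ i, (fun t : EuclideanSpace ℝ (Fin n) => t i) ⁻¹' Set.Icc 0 (T i) := by
    ext t; simp [originBox]
  rw [this]
  exact MeasurableSet.iInter fun i => measurableSet_Icc.preimage (by fun_prop)

lemma norm_le_of_forall_abs_le {x : EuclideanSpace ℝ (Fin n)} {c : ℝ} (hc : 0 ≤ c)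
    (h : ∀ i, |x i| ≤ c) : ‖x‖ ≤ n * c := by
  rw [EuclideanSpace.norm_eq]
  refine Real.sqrt_le_iff.2 ⟨by positivity, ?_⟩
  calc ∑ i, ‖x i‖ ^ 2 ≤ ∑ _i : Fin n, c ^ 2 :=
        Finset.sum_le_sum fun i _ => by
          rw [Real.norm_eq_abs]; exact pow_le_pow_left₀ (abs_nonneg _) (h i) 2
    _ = n * c ^ 2 := by simp
    _ ≤ (n * c) ^ 2 := by
        rw [mul_pow]
        gcongr
        exact_mod_cast Nat.le_self_pow two_ne_zero n

lemma norm_sub_le_of_mem_originBox {R : ℝ} (hR : 0 ≤ R) {x y : EuclideanSpace ℝ (Fin n)}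
    (hx : x ∈ originBox fun _ : Fin n => R) (hy : y ∈ originBox fun _ : Fin n => R) :
    ‖x - y‖ ≤ n * R :=
  norm_le_of_forall_abs_le hR fun i => by
    have h1 := hx i
    have h2 := hy i
    simp only [Set.mem_Icc] at h1 h2
    rw [PiLp.sub_apply, abs_le]
    constructor <;> linarith [h1.1, h1.2, h2.1, h2.2]

lemma exists_originBox_subset (T : Fin n → ℝ) :
    ∃ R : ℝ, 0 ≤ R ∧ originBox T ⊆ originBox fun _ : Fin n => R := by
  refine ⟨∑ i, |T i|, Finset.sum_nonneg fun _ _ => abs_nonneg _, fun t ht i => ⟨(ht i).1, ?_⟩⟩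
  exact (ht i).2.trans ((le_abs_self _).trans
    (Finset.single_le_sum (f := fun i => |T i|) (fun _ _ => abs_nonneg _) (Finset.mem_univ i)))

lemma isFiniteMeasure_restrict_originBox (T : Fin n → ℝ) :
    IsFiniteMeasure ((volume : Measure (EuclideanSpace ℝ (Fin n))).restrict (originBox T)) := by
  obtain ⟨R, hR, hsub⟩ := exists_originBox_subset T
  rw [isFiniteMeasure_restrict]
  refine (lt_of_le_of_lt (measure_mono (t := Metric.closedBall 0 (n * R)) fun t ht => ?_)
    measure_closedBall_lt_top).ne
  have h0 : (0 : EuclideanSpace ℝ (Fin n)) ∈ originBox fun _ : Fin n => R :=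
    fun i => ⟨le_rfl, hR⟩
  rw [Metric.mem_closedBall, dist_eq_norm]
  exact norm_sub_le_of_mem_originBox hR (hsub ht) h0

/-- The half-open box `∏ [0, ⌊Tᵢ⌋)`, the union of the unit cells of the lattice points over which
`additiveFunctional` sums. -/
def floorBox (T : Fin n → ℝ) : Set (EuclideanSpace ℝ (Fin n)) :=
  {t | ∀ i, 0 ≤ t i ∧ t i < (⌊T i⌋₊ : ℝ)}

/-- The lower corner of the unit cell containing `t` (for `t` with nonnegative coordinates). -/
noncomputable def floorPoint (t : EuclideanSpace ℝ (Fin n)) : EuclideanSpace ℝ (Fin n) :=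
  latticePoint fun i => ⌊t i⌋₊

/-- The half-open unit cell with lower corner the lattice point `i`. -/
def unitCell (i : Fin n → ℕ) : Set (EuclideanSpace ℝ (Fin n)) :=
  {t | ∀ l, t l ∈ Set.Ico (i l : ℝ) (i l + 1)}

lemma measurableSet_unitCell (i : Fin n → ℕ) : MeasurableSet (unitCell i) := by
  have : unitCell i
      = ⋂ l, (fun t : EuclideanSpace ℝ (Fin n) => t l) ⁻¹' Set.Ico (i l : ℝ) (i l + 1) := by
    ext t; simp [unitCell]
  rw [this]
  exact MeasurableSet.iInter fun i => measurableSet_Ico.preimage (by fun_prop)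

lemma volume_unitCell (i : Fin n → ℕ) : volume (unitCell i) = 1 := by
  rw [← (PiLp.volume_preserving_toLp (Fin n)).measure_preimage
    (measurableSet_unitCell i).nullMeasurableSet]
  have : (WithLp.toLp 2 : (Fin n → ℝ) → _) ⁻¹' unitCell i
      = Set.univ.pi fun l => Set.Ico (i l : ℝ) (i l + 1) := by
    ext t; simp [unitCell]
  rw [this, Real.volume_pi_Ico]
  simp

lemma floor_eq_of_mem_unitCell {i : Fin n → ℕ} {t : EuclideanSpace ℝ (Fin n)}
    (ht : t ∈ unitCell i) :
    (fun l => ⌊t l⌋₊) = i :=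
  funext fun l => (Nat.floor_eq_iff ((Nat.cast_nonneg _).trans (ht l).1)).2 (ht l)

lemma floorBox_eq_biUnion (T : Fin n → ℝ) :
    floorBox T = ⋃ i ∈ Fintype.piFinset fun l => Finset.range ⌊T l⌋₊, unitCell i := by
  ext t
  simp only [Set.mem_iUnion, exists_prop, Fintype.mem_piFinset, Finset.mem_range]
  constructor
  · intro ht
    refine ⟨fun l => ⌊t l⌋₊, fun l => ?_, fun l => ⟨Nat.floor_le (ht l).1, Nat.lt_floor_add_one _⟩⟩
    exact (Nat.floor_lt (ht l).1).2 (ht l).2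
  · rintro ⟨i, hi, ht⟩ l
    refine ⟨(Nat.cast_nonneg _).trans (ht l).1, (ht l).2.trans_le ?_⟩
    exact_mod_cast hi l

lemma measurableSet_floorBox (T : Fin n → ℝ) : MeasurableSet (floorBox T) := by
  rw [floorBox_eq_biUnion]
  exact Finset.measurableSet_biUnion _ fun i _ => measurableSet_unitCell i

lemma floorBox_subset_originBox (T : Fin n → ℝ) : floorBox T ⊆ originBox T := by
  intro t ht i
  refine ⟨(ht i).1, ?_⟩
  have h1 : 0 < ⌊T i⌋₊ := by
    have : (0 : ℝ) < (⌊T i⌋₊ : ℝ) := (ht i).1.trans_lt (ht i).2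
    exact_mod_cast this
  have h2 : 0 ≤ T i := by
    by_contra h
    rw [Nat.floor_of_nonpos (by linarith)] at h1
    exact lt_irrefl _ h1
  exact (ht i).2.le.trans (Nat.floor_le h2)

lemma measurable_comp_floorPoint (f : EuclideanSpace ℝ (Fin n) → ℝ) :
    Measurable fun t => f (floorPoint t) := by
  have h1 : Measurable fun t : EuclideanSpace ℝ (Fin n) => fun l => ⌊t l⌋₊ :=
    measurable_pi_lambda _ fun l => Nat.measurable_floor.comp (by fun_prop)
  exact (measurable_of_countable fun i : Fin n → ℕ => f (latticePoint i)).comp h1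

lemma measurable_floorPoint :
    Measurable (floorPoint : EuclideanSpace ℝ (Fin n) → EuclideanSpace ℝ (Fin n)) := by
  have h1 : Measurable fun t : EuclideanSpace ℝ (Fin n) => fun l => ⌊t l⌋₊ :=
    measurable_pi_lambda _ fun l => Nat.measurable_floor.comp (by fun_prop)
  exact (measurable_of_countable fun i : Fin n → ℕ => latticePoint i).comp h1

lemma integrableOn_unitCell_comp_floorPoint (f : EuclideanSpace ℝ (Fin n) → ℝ) (i : Fin n → ℕ) :
    IntegrableOn (fun t => f (floorPoint t)) (unitCell i) := by
  refine (integrableOn_const (C := f (latticePoint i)) (by simp [volume_unitCell])).congr_fun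
    (fun t ht => ?_) (measurableSet_unitCell i)
  simp [floorPoint, floor_eq_of_mem_unitCell ht]

lemma integrableOn_floorBox_comp_floorPoint (f : EuclideanSpace ℝ (Fin n) → ℝ) (T : Fin n → ℝ) :
    IntegrableOn (fun t => f (floorPoint t)) (floorBox T) := by
  rw [floorBox_eq_biUnion]
  exact integrableOn_finset_iUnion.2 fun i _ => integrableOn_unitCell_comp_floorPoint f i

/-- A lattice sum is the integral of a step function. -/
lemma sum_latticePoint_eq_setIntegral (f : EuclideanSpace ℝ (Fin n) → ℝ) (T : Fin n → ℝ) :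
    ∑ i ∈ Fintype.piFinset (fun l => Finset.range ⌊T l⌋₊), f (latticePoint i)
      = ∫ t in floorBox T, f (floorPoint t) := by
  rw [floorBox_eq_biUnion, integral_biUnion_finset _ (fun i _ => measurableSet_unitCell i)
    (fun i _ j _ hij => Set.disjoint_left.2 fun t hi hj => hij
      ((floor_eq_of_mem_unitCell hi).symm.trans (floor_eq_of_mem_unitCell hj)))
    fun i _ => integrableOn_unitCell_comp_floorPoint f i]
  refine Finset.sum_congr rfl fun i _ => ?_
  rw [setIntegral_congr_fun (g := fun _ => f (latticePoint i)) (measurableSet_unitCell i)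
    fun t ht => by simp [floorPoint, floor_eq_of_mem_unitCell ht]]
  simp [Measure.real, volume_unitCell]

lemma norm_sub_floorPoint_le {t : EuclideanSpace ℝ (Fin n)} (ht : ∀ i, 0 ≤ t i) :
    ‖t - floorPoint t‖ ≤ n := by
  have := norm_le_of_forall_abs_le (x := t - floorPoint t) zero_le_one fun i => ?_
  · simpa using this
  · have h1 := Nat.floor_le (ht i)
    have h2 := Nat.lt_floor_add_one (t i)
    simp only [PiLp.sub_apply, floorPoint, latticePoint]
    rw [abs_le]
    constructor <;> linarith

lemma floorPoint_mem_originBox {R : ℝ} {t : EuclideanSpace ℝ (Fin n)}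
    (ht : t ∈ originBox fun _ : Fin n => R) : floorPoint t ∈ originBox fun _ : Fin n => R :=
  fun i => ⟨Nat.cast_nonneg _, (Nat.floor_le (ht i).1).trans (ht i).2⟩

lemma smul_mem_originBox {R S : ℝ} (hR : 0 ≤ R) {t : EuclideanSpace ℝ (Fin n)}
    (ht : t ∈ originBox fun _ : Fin n => S) : R • t ∈ originBox fun _ : Fin n => R * S :=
  fun i => ⟨mul_nonneg hR (ht i).1, mul_le_mul_of_nonneg_left (ht i).2 hR⟩

/-- The singular kernel `‖u - v‖ ^ (-β)` with `β < n` is integrable on the square of the unit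
cube. -/
lemma integrable_norm_sub_rpow (hn : 1 ≤ n) {β : ℝ} (hβ : β < n) :
    Integrable (fun q : EuclideanSpace ℝ (Fin n) × EuclideanSpace ℝ (Fin n) => ‖q.1 - q.2‖ ^ (-β))
      ((volume.restrict (originBox fun _ : Fin n => 1)).prod
        (volume.restrict (originBox fun _ : Fin n => 1))) := by
  have : Nonempty (Fin n) := ⟨⟨0, hn⟩⟩
  set Q : Set (EuclideanSpace ℝ (Fin n)) := originBox fun _ : Fin n => 1 with hQ
  have hQm : MeasurableSet Q := measurableSet_originBox _
  have hQf : IsFiniteMeasure (volume.restrict Q) := isFiniteMeasure_restrict_originBox _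
  set B : Set (EuclideanSpace ℝ (Fin n)) := Metric.ball 0 (n + 1) with hB
  have h1 : Integrable (Q.indicator fun _ : EuclideanSpace ℝ (Fin n) => (1 : ℝ)) volume :=
    (integrable_indicator_iff hQm).2 (integrable_const _)
  have h2 : Integrable (B.indicator fun w : EuclideanSpace ℝ (Fin n) => ‖w‖ ^ (-β)) volume := by
    refine (integrable_indicator_iff Metric.isOpen_ball.measurableSet).2 ?_
    refine (integrableOn_fun_norm_addHaar (f := fun r => r ^ (-β)) volume).2 ?_
    rw [finrank_euclideanSpace_fin]
    have h3 : IntegrableOn (fun r : ℝ => r ^ ((n : ℝ) - 1 - β)) (Set.Ioo 0 (n + 1)) :=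
      (intervalIntegral.integrableOn_Ioo_rpow_iff (by positivity)).2 (by linarith)
    refine h3.congr_fun (fun r hr => ?_) measurableSet_Ioo
    simp only [smul_eq_mul]
    rw [← Real.rpow_natCast, ← Real.rpow_add hr.1, Nat.cast_sub hn]
    congr 1
    push_cast; ring
  have h3 := h1.convolution_integrand (ContinuousLinearMap.mul ℝ ℝ) h2
  rw [Measure.prod_restrict]
  refine (h3.integrableOn (s := Q ×ˢ Q)).congr_fun (fun q hq => ?_) (hQm.prod hQm)
  have hb : q.1 - q.2 ∈ B := by
    rw [hB, Metric.mem_ball, dist_zero_right]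
    have := norm_sub_le_of_mem_originBox zero_le_one hq.1 hq.2
    linarith
  simp [Set.indicator_of_mem hq.2, Set.indicator_of_mem hb]

end Geometry

section Weight

variable {n : ℕ} {g : EuclideanSpace ℝ (Fin n) → ℝ}

lemma IsRiemannIntegrableOnCubes.aestronglyMeasurable_cube (hg : IsRiemannIntegrableOnCubes g)
    (R : ℝ) : AEStronglyMeasurable g (volume.restrict (originBox fun _ : Fin n => R)) := by
  set Q : Set (EuclideanSpace ℝ (Fin n)) := originBox fun _ : Fin n => R with hQ
  have hQm : MeasurableSet Q := measurableSet_originBox _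
  obtain ⟨N, hsub, hNm, hN0⟩ := exists_measurable_superset_of_null (ae_iff.1 (hg R).2)
  have hc : ContinuousOn g (Q \ N) := by
    intro t ht
    refine ContinuousWithinAt.mono ?_ (Set.sdiff_subset (s := Q) (t := N))
    by_contra h
    exact ht.2 (hsub h)
  have h1 := hc.aestronglyMeasurable (μ := volume) (hQm.diff hNm)
  have h2 : volume.restrict Q = volume.restrict (Q \ N) := by
    refine Measure.restrict_congr_set ?_
    rw [Measure.restrict_apply hNm, Set.inter_comm] at hN0
    rw [← Set.sdiff_self_inter]
    exact (sdiff_null_ae_eq_self hN0).symm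
  rwa [h2]

lemma IsRiemannIntegrableOnCubes.aestronglyMeasurable_indicator
    (hg : IsRiemannIntegrableOnCubes g) (T : Fin n → ℝ) :
    AEStronglyMeasurable ((originBox T).indicator g) volume := by
  obtain ⟨R, -, hsub⟩ := exists_originBox_subset T
  rw [aestronglyMeasurable_indicator_iff (measurableSet_originBox T)]
  exact (hg.aestronglyMeasurable_cube R).mono_measure (Measure.restrict_mono hsub le_rfl)

lemma IsRiemannIntegrableOnCubes.exists_bound (hg : IsRiemannIntegrableOnCubes g)
    (T : Fin n → ℝ) : ∃ C, ∀ t ∈ originBox T, |g t| ≤ C := by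
  obtain ⟨R, -, hsub⟩ := exists_originBox_subset T
  obtain ⟨C, hC⟩ := (hg R).1
  exact ⟨C, fun t ht => hC t (hsub ht)⟩

/-- The limit of the rescaled weights is almost everywhere continuous on the unit cube. -/
lemma IsRiemannIntegrableOnCubes.ae_continuousWithinAt_limit
    (hg : IsRiemannIntegrableOnCubes g) {gstar : EuclideanSpace ℝ (Fin n) → ℝ}
    (hlim : TendstoUniformlyOn (fun (T : ℝ) t => g (T • t) / g (diagPoint n T)) gstar atTop
      (originBox (fun _ : Fin n => 1))) :
    ∀ᵐ u ∂volume.restrict (originBox fun _ : Fin n => 1),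
      ContinuousWithinAt gstar (originBox fun _ : Fin n => 1) u := by
  set Q : Set (EuclideanSpace ℝ (Fin n)) := originBox fun _ : Fin n => 1 with hQ
  have hk : ∀ k : ℕ, ∀ᵐ u, u ∈ Q →
      ContinuousWithinAt (fun t => g (((k : ℝ) + 1) • t) / g (diagPoint n ((k : ℝ) + 1))) Q u := by
    intro k
    have hpos : (0 : ℝ) < (k : ℝ) + 1 := by positivity
    have h1 := (ae_restrict_iff' (measurableSet_originBox _)).1 (hg ((k : ℝ) + 1)).2
    have h2 := (Measure.quasiMeasurePreserving_smul (volume : Measure (EuclideanSpace ℝ (Fin n)))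
      hpos.ne').ae h1
    have hmaps : Set.MapsTo (fun t : EuclideanSpace ℝ (Fin n) => ((k : ℝ) + 1) • t) Q
        (originBox fun _ : Fin n => (k : ℝ) + 1) := fun t ht => by
      simpa using smul_mem_originBox hpos.le ht
    filter_upwards [h2] with u hu huQ
    exact (ContinuousWithinAt.comp (hu (hmaps huQ)) (by fun_prop) hmaps).div_const _
  rw [ae_restrict_iff' (measurableSet_originBox _)]
  filter_upwards [ae_all_iff.2 hk] with u hu huQ
  refine continuousWithinAt_of_locally_uniform_approx_of_continuousWithinAt huQ fun V hV => ?_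
  have h1 : Tendsto (fun k : ℕ => (k : ℝ) + 1) atTop atTop :=
    tendsto_natCast_atTop_atTop.atTop_add tendsto_const_nhds
  obtain ⟨k, hk⟩ := (h1.eventually (hlim V hV)).exists
  exact ⟨Q, self_mem_nhdsWithin, _, hu k huQ, fun y hy => hk y hy⟩

end Weight

/-! ### The difference of the two functionals -/

section HermiteDifference

variable {n : ℕ} {Ω S : Type*} [MeasurableSpace Ω] {P : Measure Ω}
  {ξ : EuclideanSpace ℝ (Fin n) → Ω → ℝ} {α : ℝ} {L : ℝ → ℝ}

/-- The difference of the weighted Hermite transforms of the field, sampled along `φ` with weight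
`a` and along `ψ` with weight `b`. -/
noncomputable def hermiteDiff (m : ℕ) (ξ : EuclideanSpace ℝ (Fin n) → Ω → ℝ) (a b : S → ℝ)
    (φ ψ : S → EuclideanSpace ℝ (Fin n)) (s : S) (ω : Ω) : ℝ :=
  a s * hermiteFun m (ξ (φ s) ω) - b s * hermiteFun m (ξ (ψ s) ω)

/-- The kernel such that `m!` times it is the covariance of `hermiteDiff`; see
`IsLongRangeGaussianField.integral_hermiteDiff_mul`. -/
noncomputable def covKernel (m : ℕ) (α : ℝ) (L : ℝ → ℝ) (a b : S → ℝ)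
    (φ ψ : S → EuclideanSpace ℝ (Fin n)) (q : S × S) : ℝ :=
  a q.1 * a q.2 * radialCorr α L ‖φ q.1 - φ q.2‖ ^ m
    - a q.1 * b q.2 * radialCorr α L ‖φ q.1 - ψ q.2‖ ^ m
    - b q.1 * a q.2 * radialCorr α L ‖ψ q.1 - φ q.2‖ ^ m
    + b q.1 * b q.2 * radialCorr α L ‖ψ q.1 - ψ q.2‖ ^ m

/-- The integral functional as an integral of `hermiteDiff` with zero second weight. -/
lemma hermiteDiff_indicator_zero {Ω : Type*} {ξ : EuclideanSpace ℝ (Fin n) → Ω → ℝ}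
    {g : EuclideanSpace ℝ (Fin n) → ℝ} {m : ℕ} (T : Fin n → ℝ)
    (t : EuclideanSpace ℝ (Fin n)) (ω : Ω) :
    hermiteDiff m ξ ((originBox T).indicator g) (fun _ => 0) id id t ω
      = (originBox T).indicator (fun t => g t * hermiteFun m (ξ t ω)) t := by
  simp only [hermiteDiff, zero_mul, sub_zero, id]
  exact (Set.indicator_mul_left (originBox T) g fun t => hermiteFun m (ξ t ω)).symm

lemma abs_covKernel_le {m : ℕ} {a b : S → ℝ} {φ ψ : S → EuclideanSpace ℝ (Fin n)} {q : S × S}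
    {M K : ℝ} (ha1 : |a q.1| ≤ M) (ha2 : |a q.2| ≤ M) (hb1 : |b q.1| ≤ M) (hb2 : |b q.2| ≤ M)
    (h : ∀ x ∈ ({φ q.1, ψ q.1} : Set (EuclideanSpace ℝ (Fin n))),
      ∀ y ∈ ({φ q.2, ψ q.2} : Set (EuclideanSpace ℝ (Fin n))),
        |radialCorr α L ‖x - y‖ ^ m| ≤ K) :
    |covKernel m α L a b φ ψ q| ≤ 4 * (M ^ 2 * K) := by
  have hM : 0 ≤ M := (abs_nonneg _).trans ha1
  have key : ∀ x y z : ℝ, |x| ≤ M → |y| ≤ M → |z| ≤ K → |x * y * z| ≤ M ^ 2 * K := by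
    intro x y z hx hy hz
    rw [abs_mul, abs_mul, sq]
    gcongr
  have h1 := key _ _ _ ha1 ha2 (h (φ q.1) (by simp) (φ q.2) (by simp))
  have h2 := key _ _ _ ha1 hb2 (h (φ q.1) (by simp) (ψ q.2) (by simp))
  have h3 := key _ _ _ hb1 ha2 (h (ψ q.1) (by simp) (φ q.2) (by simp))
  have h4 := key _ _ _ hb1 hb2 (h (ψ q.1) (by simp) (ψ q.2) (by simp))
  unfold covKernel
  rw [abs_le] at *
  constructor <;> linarith [h1.1, h1.2, h2.1, h2.2, h3.1, h3.2, h4.1, h4.2]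

namespace IsLongRangeGaussianField

variable {a b : S → ℝ} {φ ψ : S → EuclideanSpace ℝ (Fin n)} {m : ℕ}

lemma memLp_hermiteDiff (hξ : IsLongRangeGaussianField P ξ α L) (s : S) :
    MemLp (hermiteDiff m ξ a b φ ψ s) 2 P :=
  ((hξ.memLp_hermiteFun m _).const_mul _).sub ((hξ.memLp_hermiteFun m _).const_mul _)

lemma memLp_additiveFunctional (hξ : IsLongRangeGaussianField P ξ α L)
    (g : EuclideanSpace ℝ (Fin n) → ℝ) (T : Fin n → ℝ) : MemLp (additiveFunctional g m ξ T) 2 P :=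
  memLp_finsetSum _ fun _ _ => (hξ.memLp_hermiteFun m _).const_mul _

lemma integral_hermiteDiff_mul (hξ : IsLongRangeGaussianField P ξ α L) (q : S × S) :
    ∫ ω, hermiteDiff m ξ a b φ ψ q.1 ω * hermiteDiff m ξ a b φ ψ q.2 ω ∂P
      = (m.factorial : ℝ) * covKernel m α L a b φ ψ q := by
  have hi : ∀ c x y, Integrable
      (fun ω => c * (hermiteFun m (ξ x ω) * hermiteFun m (ξ y ω))) P := fun c x y =>
    ((hξ.memLp_hermiteFun m x).integrable_mul (hξ.memLp_hermiteFun m y)).const_mul c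
  have e : ∀ ω, hermiteDiff m ξ a b φ ψ q.1 ω * hermiteDiff m ξ a b φ ψ q.2 ω
      = (a q.1 * a q.2) * (hermiteFun m (ξ (φ q.1) ω) * hermiteFun m (ξ (φ q.2) ω))
        - (a q.1 * b q.2) * (hermiteFun m (ξ (φ q.1) ω) * hermiteFun m (ξ (ψ q.2) ω))
        - (b q.1 * a q.2) * (hermiteFun m (ξ (ψ q.1) ω) * hermiteFun m (ξ (φ q.2) ω))
        + (b q.1 * b q.2) * (hermiteFun m (ξ (ψ q.1) ω) * hermiteFun m (ξ (ψ q.2) ω)) := by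
    intro ω; unfold hermiteDiff; ring
  simp_rw [e]
  rw [integral_add (by exact ((hi _ _ _).sub (hi _ _ _)).sub (hi _ _ _)) (hi _ _ _),
    integral_sub (by exact (hi _ _ _).sub (hi _ _ _)) (hi _ _ _),
    integral_sub (hi _ _ _) (hi _ _ _)]
  simp only [integral_const_mul, hξ.integral_hermiteFun_mul]
  unfold covKernel
  ring

lemma integral_hermiteDiff_sq_le (hξ : IsLongRangeGaussianField P ξ α L) {M : ℝ}
    (ha : ∀ s, |a s| ≤ M) (hb : ∀ s, |b s| ≤ M) (s : S) :
    ∫ ω, hermiteDiff m ξ a b φ ψ s ω ^ 2 ∂P ≤ m.factorial * (4 * (M ^ 2 * 1)) := by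
  simp_rw [sq (hermiteDiff m ξ a b φ ψ s _)]
  rw [hξ.integral_hermiteDiff_mul (s, s)]
  gcongr
  refine (le_abs_self _).trans (abs_covKernel_le (ha s) (ha s) (hb s) (hb s) fun x _ y _ => ?_)
  have h0 := radialCorr_pos (α := α) hξ.slowlyVarying (norm_nonneg (x - y))
  rw [abs_of_nonneg (by positivity)]
  exact pow_le_one₀ h0.le (hξ.radialCorr_norm_le_one x y)

lemma aestronglyMeasurable_hermiteDiff [MeasurableSpace S]
    (hξ : IsLongRangeGaussianField P ξ α L) {μ : Measure S}
    (ha : AEStronglyMeasurable a μ) (hb : AEStronglyMeasurable b μ) (hφ : Measurable φ)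
    (hψ : Measurable ψ) :
    AEStronglyMeasurable (fun p : S × Ω => hermiteDiff m ξ a b φ ψ p.1 p.2) (μ.prod P) := by
  have h : ∀ χ : S → EuclideanSpace ℝ (Fin n), Measurable χ →
      AEStronglyMeasurable (fun p : S × Ω => hermiteFun m (ξ (χ p.1) p.2)) (μ.prod P) := by
    intro χ hχ
    have h1 : Measurable fun p : S × Ω => Function.uncurry ξ (χ p.1, p.2) :=
      hξ.measurable.comp ((hχ.comp measurable_fst).prodMk measurable_snd)
    exact ((continuous_hermiteFun m).measurable.comp h1).aestronglyMeasurable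
  have := hξ.gaussian.isProbabilityMeasure
  exact ((ha.comp_quasiMeasurePreserving Measure.quasiMeasurePreserving_fst).mul (h φ hφ)).sub
    ((hb.comp_quasiMeasurePreserving Measure.quasiMeasurePreserving_fst).mul (h ψ hψ))

end IsLongRangeGaussianField

end HermiteDifference

section Functionals

variable {n : ℕ} {Ω : Type*} [MeasurableSpace Ω] {P : Measure Ω} [IsProbabilityMeasure P]
  {ξ : EuclideanSpace ℝ (Fin n) → Ω → ℝ} {α : ℝ} {L : ℝ → ℝ}
  {g : EuclideanSpace ℝ (Fin n) → ℝ} {m : ℕ}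

lemma IsRiemannIntegrableOnCubes.exists_indicator_bound (hg : IsRiemannIntegrableOnCubes g)
    (T : Fin n → ℝ) : ∃ M, ∀ t, |(originBox T).indicator g t| ≤ M := by
  obtain ⟨C, hC⟩ := hg.exists_bound T
  refine ⟨max C 0, fun t => ?_⟩
  by_cases ht : t ∈ originBox T
  · rw [Set.indicator_of_mem ht]; exact (hC t ht).trans (le_max_left _ _)
  · rw [Set.indicator_of_notMem ht, abs_zero]; exact le_max_right _ _

lemma floorPoint_mem_originBox_of_mem_floorBox {T : Fin n → ℝ} {t : EuclideanSpace ℝ (Fin n)}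
    (ht : t ∈ floorBox T) : floorPoint t ∈ originBox T :=
  fun i => ⟨Nat.cast_nonneg _, (Nat.floor_le (ht i).1).trans
    (floorBox_subset_originBox T ht i).2⟩

lemma abs_indicator_floorBox_le {T : Fin n → ℝ} {M : ℝ}
    (hM : ∀ t, |(originBox T).indicator g t| ≤ M) (t : EuclideanSpace ℝ (Fin n)) :
    |(floorBox T).indicator (fun t => g (floorPoint t)) t| ≤ M := by
  by_cases ht : t ∈ floorBox T
  · have h := hM (floorPoint t)
    rw [Set.indicator_of_mem (floorPoint_mem_originBox_of_mem_floorBox ht)] at h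
    rw [Set.indicator_of_mem ht]
    exact h
  · rw [Set.indicator_of_notMem ht, abs_zero]; exact (abs_nonneg _).trans (hM t)

lemma aestronglyMeasurable_indicator_floorBox (T : Fin n → ℝ) :
    AEStronglyMeasurable ((floorBox T).indicator fun t => g (floorPoint t)) volume :=
  ((measurable_comp_floorPoint g).indicator (measurableSet_floorBox T)).aestronglyMeasurable

lemma IsLongRangeGaussianField.ae_integrableOn (hξ : IsLongRangeGaussianField P ξ α L)
    (hg : IsRiemannIntegrableOnCubes g) (T : Fin n → ℝ) :
    ∀ᵐ ω ∂P, IntegrableOn (fun t => g t * hermiteFun m (ξ t ω)) (originBox T) := by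
  obtain ⟨M, hM⟩ := hg.exists_indicator_bound T
  have := isFiniteMeasure_restrict_originBox T
  have h := ae_integrable_of_secondMoment_le (μ := volume.restrict (originBox T))
    (hξ.aestronglyMeasurable_hermiteDiff (m := m)
      ((hg.aestronglyMeasurable_indicator T).mono_measure Measure.restrict_le_self)
      (aestronglyMeasurable_const (b := (0 : ℝ))) measurable_id measurable_id)
    hξ.memLp_hermiteDiff
    (hξ.integral_hermiteDiff_sq_le hM fun _ => by simpa using (abs_nonneg _).trans (hM 0))
  filter_upwards [h] with ω hω
  refine IntegrableOn.congr_fun hω (fun t ht => ?_) (measurableSet_originBox T)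
  rw [hermiteDiff_indicator_zero, Set.indicator_of_mem ht]

lemma IsLongRangeGaussianField.memLp_integralFunctional (hξ : IsLongRangeGaussianField P ξ α L)
    (hg : IsRiemannIntegrableOnCubes g) (T : Fin n → ℝ) :
    MemLp (integralFunctional g m ξ T) 2 P := by
  obtain ⟨M, hM⟩ := hg.exists_indicator_bound T
  have := isFiniteMeasure_restrict_originBox T
  have h := memLp_two_integral (μ := volume.restrict (originBox T))
    (hξ.aestronglyMeasurable_hermiteDiff (m := m)
      ((hg.aestronglyMeasurable_indicator T).mono_measure Measure.restrict_le_self)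
      (aestronglyMeasurable_const (b := (0 : ℝ))) measurable_id measurable_id)
    hξ.memLp_hermiteDiff
    (hξ.integral_hermiteDiff_sq_le hM fun _ => by simpa using (abs_nonneg _).trans (hM 0))
  refine (memLp_congr_ae (.of_forall fun ω => ?_)).1 h
  refine setIntegral_congr_fun (measurableSet_originBox T) fun t ht => ?_
  rw [hermiteDiff_indicator_zero, Set.indicator_of_mem ht]

/-- The rescaled weight of the integral functional. -/
noncomputable def boxWeight (g : EuclideanSpace ℝ (Fin n) → ℝ) (T : Fin n → ℝ) (τ : ℝ)
    (u : EuclideanSpace ℝ (Fin n)) : ℝ :=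
  (originBox T).indicator g (τ • u) / g (diagPoint n τ)

/-- The rescaled weight of the additive functional, as a step function. -/
noncomputable def stepWeight (g : EuclideanSpace ℝ (Fin n) → ℝ) (T : Fin n → ℝ) (τ : ℝ)
    (u : EuclideanSpace ℝ (Fin n)) : ℝ :=
  (floorBox T).indicator (fun t => g (floorPoint t)) (τ • u) / g (diagPoint n τ)

/-- The difference of the two functionals, rescaled to the unit cube. -/
lemma IsLongRangeGaussianField.ae_functional_sub_eq (hξ : IsLongRangeGaussianField P ξ α L)
    (hg : IsRiemannIntegrableOnCubes g) {T : Fin n → ℝ} {τ : ℝ} (hτ : 0 < τ) (hT : ∀ i, T i ≤ τ)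
    (hγ : g (diagPoint n τ) ≠ 0) :
    ∀ᵐ ω ∂P, integralFunctional g m ξ T ω - additiveFunctional g m ξ T ω
      = τ ^ n * g (diagPoint n τ) * ∫ u in originBox fun _ : Fin n => 1,
          hermiteDiff m ξ (boxWeight g T τ) (stepWeight g T τ) (fun u => τ • u)
            (fun u => floorPoint (τ • u)) u ω := by
  filter_upwards [hξ.ae_integrableOn (m := m) hg T] with ω hω
  set F : EuclideanSpace ℝ (Fin n) → ℝ := fun t =>
    (originBox T).indicator (fun t => g t * hermiteFun m (ξ t ω)) t
      - (floorBox T).indicator (fun t => g (floorPoint t) * hermiteFun m (ξ (floorPoint t) ω)) t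
    with hF
  have h1 : integralFunctional g m ξ T ω - additiveFunctional g m ξ T ω = ∫ t, F t := by
    rw [hF, integral_sub ((integrable_indicator_iff (measurableSet_originBox T)).2 hω)
      ((integrable_indicator_iff (measurableSet_floorBox T)).2
        (integrableOn_floorBox_comp_floorPoint (fun t => g t * hermiteFun m (ξ t ω)) T)),
      integral_indicator (measurableSet_originBox T), integral_indicator (measurableSet_floorBox T)]
    congr 1
    exact sum_latticePoint_eq_setIntegral (fun t => g t * hermiteFun m (ξ t ω)) T
  have h2 : ∫ t, F t = τ ^ n * ∫ u, F (τ • u) := by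
    rw [Measure.integral_comp_smul, finrank_euclideanSpace_fin, abs_of_pos (by positivity),
      smul_eq_mul, mul_inv_cancel_left₀ (by positivity)]
  have h3 : ∫ u, F (τ • u) = ∫ u in originBox fun _ : Fin n => 1, F (τ • u) := by
    refine (setIntegral_eq_integral_of_forall_compl_eq_zero fun u hu => ?_).symm
    have hu' : τ • u ∉ originBox T := fun h => hu fun i => by
      have h' := h i
      simp only [PiLp.smul_apply, smul_eq_mul, Set.mem_Icc] at h'
      refine ⟨nonneg_of_mul_nonneg_right h'.1 hτ, ?_⟩
      exact le_of_mul_le_mul_left (by linarith [hT i]) hτ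
    rw [hF]
    simp only
    rw [Set.indicator_of_notMem hu',
      Set.indicator_of_notMem fun h => hu' (floorBox_subset_originBox T h), sub_zero]
  rw [h1, h2, h3, mul_assoc]
  congr 1
  rw [← integral_const_mul]
  refine integral_congr_ae (.of_forall fun u => ?_)
  simp only [hF, hermiteDiff, boxWeight, stepWeight]
  rw [Set.indicator_mul_left (originBox T) g fun t => hermiteFun m (ξ t ω),
    Set.indicator_mul_left (floorBox T) (fun t => g (floorPoint t))
      fun t => hermiteFun m (ξ (floorPoint t) ω)]
  field_simp

/-- The second moment of the difference of the two functionals as a double integral over the unit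
cube. -/
lemma IsLongRangeGaussianField.integral_functional_sub_sq (hξ : IsLongRangeGaussianField P ξ α L)
    (hg : IsRiemannIntegrableOnCubes g) {T : Fin n → ℝ} {τ : ℝ} (hτ : 0 < τ) (hT : ∀ i, T i ≤ τ)
    (hγ : g (diagPoint n τ) ≠ 0) :
    AEStronglyMeasurable (covKernel m α L (boxWeight g T τ) (stepWeight g T τ) (fun u => τ • u)
        (fun u => floorPoint (τ • u)))
        ((volume.restrict (originBox fun _ : Fin n => 1)).prod
          (volume.restrict (originBox fun _ : Fin n => 1))) ∧
    ∫ ω, (integralFunctional g m ξ T ω - additiveFunctional g m ξ T ω) ^ 2 ∂P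
      = (τ ^ n * g (diagPoint n τ)) ^ 2 * (m.factorial *
        ∫ q, covKernel m α L (boxWeight g T τ) (stepWeight g T τ) (fun u => τ • u)
            (fun u => floorPoint (τ • u)) q
          ∂(volume.restrict (originBox fun _ : Fin n => 1)).prod
            (volume.restrict (originBox fun _ : Fin n => 1))) := by
  set Q : Set (EuclideanSpace ℝ (Fin n)) := originBox fun _ : Fin n => 1
  have hQ : IsFiniteMeasure (volume.restrict Q) := isFiniteMeasure_restrict_originBox _
  obtain ⟨M, hM⟩ := hg.exists_indicator_bound T
  have hsm := Measure.quasiMeasurePreserving_smul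
    (volume : Measure (EuclideanSpace ℝ (Fin n))) hτ.ne'
  have hsmul : Measurable fun u : EuclideanSpace ℝ (Fin n) => τ • u := measurable_const_smul τ
  have hmeas := hξ.aestronglyMeasurable_hermiteDiff (m := m) (μ := volume.restrict Q)
    (a := boxWeight g T τ) (b := stepWeight g T τ) (φ := fun u => τ • u)
    (ψ := fun u => floorPoint (τ • u))
    (((hg.aestronglyMeasurable_indicator T).comp_quasiMeasurePreserving
      hsm).aemeasurable.div_const _).aestronglyMeasurable.restrict
    (((aestronglyMeasurable_indicator_floorBox T).comp_quasiMeasurePreserving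
      hsm).aemeasurable.div_const _).aestronglyMeasurable.restrict
    hsmul (measurable_floorPoint.comp hsmul)
  have hbd := hξ.integral_hermiteDiff_sq_le (m := m) (M := M / |g (diagPoint n τ)|)
    (a := boxWeight g T τ) (b := stepWeight g T τ) (φ := fun u => τ • u)
    (ψ := fun u => floorPoint (τ • u))
    (fun u => by rw [boxWeight, abs_div]; gcongr; exact hM _)
    (fun u => by rw [stepWeight, abs_div]; gcongr; exact abs_indicator_floorBox_le hM _)
  have hcov : ∀ q, covKernel m α L (boxWeight g T τ) (stepWeight g T τ) (fun u => τ • u)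
      (fun u => floorPoint (τ • u)) q = (m.factorial : ℝ)⁻¹ *
        ∫ ω, hermiteDiff m ξ (boxWeight g T τ) (stepWeight g T τ) (fun u => τ • u)
          (fun u => floorPoint (τ • u)) q.1 ω * hermiteDiff m ξ (boxWeight g T τ)
          (stepWeight g T τ) (fun u => τ • u) (fun u => floorPoint (τ • u)) q.2 ω ∂P := by
    intro q
    rw [hξ.integral_hermiteDiff_mul, inv_mul_cancel_left₀ (by positivity)]
  constructor
  · rw [funext hcov]
    exact (aestronglyMeasurable_mul_pair hmeas).integral_prod_right'.const_mul _
  · have h1 : ∫ ω, (integralFunctional g m ξ T ω - additiveFunctional g m ξ T ω) ^ 2 ∂P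
        = ∫ ω, (τ ^ n * g (diagPoint n τ)) ^ 2 * (∫ u in Q,
          hermiteDiff m ξ (boxWeight g T τ) (stepWeight g T τ) (fun u => τ • u)
            (fun u => floorPoint (τ • u)) u ω) ^ 2 ∂P := by
      refine integral_congr_ae ?_
      filter_upwards [hξ.ae_functional_sub_eq (m := m) hg hτ hT hγ] with ω hω
      rw [hω, mul_pow]
    rw [h1, integral_const_mul, integral_sq_integral hmeas hξ.memLp_hermiteDiff hbd]
    simp_rw [hξ.integral_hermiteDiff_mul]
    rw [integral_const_mul]

end Functionals

/-! ### Limits and domination of the rescaled weights and covariances -/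

section Limits

variable {n : ℕ} {α : ℝ} {L : ℝ → ℝ} {g gstar : EuclideanSpace ℝ (Fin n) → ℝ}
  {ι : Type*} {l : Filter ι} {T : ι → Fin n → ℝ} {τ : ι → ℝ} {a : Fin n → ℝ}
  {u : EuclideanSpace ℝ (Fin n)}

lemma norm_smul_sub_floorPoint_le {r R : ℝ} (hr : 0 ≤ r)
    (hu : u ∈ originBox fun _ : Fin n => R) : ‖r • u - floorPoint (r • u)‖ ≤ n :=
  norm_sub_floorPoint_le fun i => mul_nonneg hr (hu i).1

/-- Rescaled lattice approximations of a point of the unit cube converge to it within the cube. -/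
lemma tendsto_inv_smul_floorPoint (hτ : Tendsto τ l atTop)
    (hu : u ∈ originBox fun _ : Fin n => 1) :
    Tendsto (fun s => (τ s)⁻¹ • floorPoint (τ s • u)) l (𝓝[originBox fun _ : Fin n => 1] u) := by
  refine tendsto_nhdsWithin_iff.2 ⟨?_, ?_⟩
  · have h0 : Tendsto (fun s => (τ s)⁻¹ * n) l (𝓝 0) := by
      simpa using hτ.inv_tendsto_atTop.mul_const (n : ℝ)
    refine tendsto_iff_norm_sub_tendsto_zero.2
      (squeeze_zero' (.of_forall fun _ => norm_nonneg _) ?_ h0)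
    filter_upwards [hτ.eventually_gt_atTop 0] with s hs
    have e : (τ s)⁻¹ • floorPoint (τ s • u) - u
        = -((τ s)⁻¹ • (τ s • u - floorPoint (τ s • u))) := by
      rw [smul_sub, inv_smul_smul₀ hs.ne']; abel
    rw [e, norm_neg, norm_smul, norm_inv, Real.norm_of_nonneg hs.le]
    gcongr
    exact norm_smul_sub_floorPoint_le hs.le hu
  · filter_upwards [hτ.eventually_gt_atTop 0] with s hs
    have h1 : τ s • u ∈ originBox fun _ : Fin n => τ s := by
      simpa using smul_mem_originBox hs.le hu
    have h2 := smul_mem_originBox (inv_nonneg.2 hs.le) (floorPoint_mem_originBox h1)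
    simpa [inv_mul_cancel₀ hs.ne'] using h2

/-- The limit of both rescaled weights when `T / τ → a`: the limit weight cut off to the box
with upper corner `a`. -/
noncomputable def limitWeight (gstar : EuclideanSpace ℝ (Fin n) → ℝ) (a : Fin n → ℝ)
    (u : EuclideanSpace ℝ (Fin n)) : ℝ :=
  open scoped Classical in if ∀ i, u i < a i then gstar u else 0

/-- Away from the boundary of the limit box, a point is eventually inside both rescaled boxes or
eventually outside both. -/
lemma eventually_mem_or_notMem_boxes (hτ : Tendsto τ l atTop)
    (ha : ∀ i, Tendsto (fun s => T s i / τ s) l (𝓝 (a i)))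
    (hu : u ∈ originBox fun _ : Fin n => 1) (hua : ∀ i, u i ≠ a i) :
    ((∀ i, u i < a i) ∧ ∀ᶠ s in l, τ s • u ∈ floorBox (T s)) ∨
      ((¬ ∀ i, u i < a i) ∧ ∀ᶠ s in l, τ s • u ∉ originBox (T s)) := by
  by_cases h : ∀ i, u i < a i
  · refine Or.inl ⟨h, ?_⟩
    have h1 : ∀ i, ∀ᶠ s in l, u i < T s i / τ s - (τ s)⁻¹ := fun i =>
      ((ha i).sub hτ.inv_tendsto_atTop).eventually_const_lt (by simpa using h i)
    filter_upwards [eventually_all.2 h1, hτ.eventually_gt_atTop 0] with s hs hs0 i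
    refine ⟨mul_nonneg hs0.le (hu i).1, ?_⟩
    have h2 := hs i
    rw [div_eq_mul_inv, ← sub_one_mul, ← div_eq_mul_inv, lt_div_iff₀ hs0] at h2
    have h3 := Nat.lt_floor_add_one (T s i)
    simp only [PiLp.smul_apply, smul_eq_mul]
    linarith
  · refine Or.inr ⟨h, ?_⟩
    push Not at h
    obtain ⟨i, hi⟩ := h
    have hi' : a i < u i := lt_of_le_of_ne hi (hua i).symm
    filter_upwards [(ha i).eventually_lt_const hi', hτ.eventually_gt_atTop 0] with s hs hs0 hmem
    have h2 := (hmem i).2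
    simp only [PiLp.smul_apply, smul_eq_mul] at h2
    rw [div_lt_iff₀ hs0] at hs
    linarith

lemma tendsto_boxWeight
    (hlim : TendstoUniformlyOn (fun (T : ℝ) t => g (T • t) / g (diagPoint n T)) gstar atTop
      (originBox (fun _ : Fin n => 1)))
    (hτ : Tendsto τ l atTop)
    (ha : ∀ i, Tendsto (fun s => T s i / τ s) l (𝓝 (a i)))
    (hu : u ∈ originBox fun _ : Fin n => 1) (hua : ∀ i, u i ≠ a i) :
    Tendsto (fun s => boxWeight g (T s) (τ s) u) l (𝓝 (limitWeight gstar a u)) := by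
  rcases eventually_mem_or_notMem_boxes hτ ha hu hua with ⟨h, h'⟩ | ⟨h, h'⟩
  · rw [limitWeight, if_pos h]
    refine ((hlim.tendsto_at hu).comp hτ).congr' ?_
    filter_upwards [h'] with s hs
    rw [boxWeight, Set.indicator_of_mem (floorBox_subset_originBox _ hs)]
    rfl
  · rw [limitWeight, if_neg h]
    refine tendsto_const_nhds.congr' ?_
    filter_upwards [h'] with s hs
    rw [boxWeight, Set.indicator_of_notMem hs, zero_div]

lemma tendsto_stepWeight
    (hlim : TendstoUniformlyOn (fun (T : ℝ) t => g (T • t) / g (diagPoint n T)) gstar atTop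
      (originBox (fun _ : Fin n => 1)))
    (hτ : Tendsto τ l atTop)
    (ha : ∀ i, Tendsto (fun s => T s i / τ s) l (𝓝 (a i)))
    (hu : u ∈ originBox fun _ : Fin n => 1) (hua : ∀ i, u i ≠ a i)
    (hcont : ContinuousWithinAt gstar (originBox fun _ : Fin n => 1) u) :
    Tendsto (fun s => stepWeight g (T s) (τ s) u) l (𝓝 (limitWeight gstar a u)) := by
  rcases eventually_mem_or_notMem_boxes hτ ha hu hua with ⟨h, h'⟩ | ⟨h, h'⟩
  · rw [limitWeight, if_pos h]
    have hlim' : TendstoUniformlyOn (fun s t => g (τ s • t) / g (diagPoint n (τ s))) gstar l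
        (originBox (fun _ : Fin n => 1)) := fun V hV => hτ.eventually (hlim V hV)
    refine (hlim'.tendsto_comp hcont (tendsto_inv_smul_floorPoint hτ hu)).congr' ?_
    filter_upwards [h', hτ.eventually_gt_atTop 0] with s hs hs0
    rw [stepWeight, Set.indicator_of_mem hs, smul_inv_smul₀ hs0.ne']
  · rw [limitWeight, if_neg h]
    refine tendsto_const_nhds.congr' ?_
    filter_upwards [h'] with s hs
    rw [stepWeight, Set.indicator_of_notMem fun h => hs (floorBox_subset_originBox _ h), zero_div]

/-- The rescaled weights are eventually bounded, uniformly on the unit cube. -/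
lemma exists_weight_bound
    (hlim : TendstoUniformlyOn (fun (T : ℝ) t => g (T • t) / g (diagPoint n T)) gstar atTop
      (originBox (fun _ : Fin n => 1)))
    (hg : IsRiemannIntegrableOnCubes g) (hτ : Tendsto τ l atTop) :
    ∃ M, 0 ≤ M ∧ ∀ᶠ s in l, ∀ u ∈ originBox fun _ : Fin n => 1,
      |boxWeight g (T s) (τ s) u| ≤ M ∧ |stepWeight g (T s) (τ s) u| ≤ M := by
  have hunif := Metric.tendstoUniformlyOn_iff.1 hlim 1 one_pos
  obtain ⟨r, hr, hr0⟩ := (hunif.and (eventually_gt_atTop 0)).exists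
  obtain ⟨C, hC⟩ := (hg r).1
  have hstar : ∀ u ∈ originBox fun _ : Fin n => 1, |gstar u| ≤ 1 + |C| / |g (diagPoint n r)| := by
    intro u hu
    have h1 := hr u hu
    rw [Real.dist_eq] at h1
    have h2 : |g (r • u) / g (diagPoint n r)| ≤ |C| / |g (diagPoint n r)| := by
      rw [abs_div]
      exact div_le_div_of_nonneg_right
        ((hC _ (by simpa using smul_mem_originBox hr0.le hu)).trans (le_abs_self C)) (abs_nonneg _)
    have h3 := abs_sub_abs_le_abs_sub (gstar u) (g (r • u) / g (diagPoint n r))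
    linarith
  refine ⟨2 + |C| / |g (diagPoint n r)|, by positivity, ?_⟩
  filter_upwards [hτ.eventually hunif, hτ.eventually_gt_atTop 0] with s hs hs0 u hu
  have hpos : 0 ≤ 2 + |C| / |g (diagPoint n r)| := by positivity
  have hle : ∀ v ∈ originBox fun _ : Fin n => 1,
      |g (τ s • v) / g (diagPoint n (τ s))| ≤ 2 + |C| / |g (diagPoint n r)| := by
    intro v hv
    have h1 := hs v hv
    rw [Real.dist_eq, abs_sub_comm] at h1
    have h3 := abs_sub_abs_le_abs_sub (g (τ s • v) / g (diagPoint n (τ s))) (gstar v)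
    linarith [hstar v hv]
  constructor
  · by_cases h : τ s • u ∈ originBox (T s)
    · rw [boxWeight, Set.indicator_of_mem h]; exact hle u hu
    · rw [boxWeight, Set.indicator_of_notMem h, zero_div, abs_zero]; exact hpos
  · by_cases h : τ s • u ∈ floorBox (T s)
    · rw [stepWeight, Set.indicator_of_mem h]
      have h1 : τ s • u ∈ originBox fun _ : Fin n => τ s := by
        simpa using smul_mem_originBox hs0.le hu
      have h2 := smul_mem_originBox (inv_nonneg.2 hs0.le) (floorPoint_mem_originBox h1)
      rw [inv_mul_cancel₀ hs0.ne'] at h2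
      have h3 := hle _ h2
      rwa [smul_inv_smul₀ hs0.ne'] at h3
    · rw [stepWeight, Set.indicator_of_notMem h, zero_div, abs_zero]; exact hpos

lemma tendsto_radialCorr_norm_sub (hL : IsSlowlyVarying L) (hc : ContinuousOn L (Set.Ioi 0))
    (hτ : Tendsto τ l atTop) {p q : ι → EuclideanSpace ℝ (Fin n)}
    {v : EuclideanSpace ℝ (Fin n)} (hp : Tendsto (fun s => (τ s)⁻¹ • p s) l (𝓝 u))
    (hq : Tendsto (fun s => (τ s)⁻¹ • q s) l (𝓝 v)) (huv : u ≠ v) (m : ℕ) :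
    Tendsto (fun s => radialCorr α L ‖p s - q s‖ ^ m / radialCorr α L (τ s) ^ m) l
      (𝓝 ((‖u - v‖ ^ (-α)) ^ m)) := by
  have h := (tendsto_radialCorr_ratio (α := α) hL hc hτ (norm_pos_iff.2 (sub_ne_zero.2 huv))
    (hp.sub hq).norm).pow m
  refine h.congr' ?_
  filter_upwards [hτ.eventually_gt_atTop 0] with s hs
  rw [div_pow, ← smul_sub, norm_smul, norm_inv, Real.norm_of_nonneg hs.le,
    mul_inv_cancel_left₀ hs.ne']

/-- The normalized covariance kernel is dominated by an integrable singular kernel, also when the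
two points are replaced by the corners of their lattice cells. -/
lemma IsLongRangeGaussianField.exists_kernel_bound {Ω : Type*} [MeasurableSpace Ω]
    {P : Measure Ω} {ξ : EuclideanSpace ℝ (Fin n) → Ω → ℝ} {m : ℕ}
    (hξ : IsLongRangeGaussianField P ξ α L) (hn : 1 ≤ n) (hm : 1 ≤ m) (hα : 0 < α)
    (hαm : α < (n : ℝ) / m) :
    ∃ β < (n : ℝ), ∃ C > 0, ∃ X ≥ 1, ∀ r ≥ X, ∀ u v p q : EuclideanSpace ℝ (Fin n), u ≠ v →
      ‖r • u - p‖ ≤ n → ‖r • v - q‖ ≤ n → ‖p - q‖ ≤ n * r →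
      radialCorr α L ‖p - q‖ ^ m / radialCorr α L r ^ m ≤ C * ‖u - v‖ ^ (-β) := by
  have hm0 : (0 : ℝ) < m := by exact_mod_cast hm
  have hn1 : (1 : ℝ) ≤ n := by exact_mod_cast hn
  set ε := ((n : ℝ) / m - α) / 2 with hε
  have hε0 : 0 < ε := by rw [hε]; linarith
  have hβ : (α + ε) * m < n := by
    rw [← lt_div_iff₀ hm0]; linarith
  obtain ⟨C, hC, X, hX, hbound⟩ := exists_radialCorr_bound hα hξ.slowlyVarying
    (hξ.continuousOn_slowlyVarying hn) (fun r hr => hξ.radialCorr_le_one hn hr) hε0 hn1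
  refine ⟨(α + ε) * m, hβ, C ^ m * ((2 * n + 1) ^ (α + ε)) ^ m, by positivity, X, hX,
    fun r hr u v p q huv hp hq hpq => ?_⟩
  have hr0 : 0 < r := by linarith
  have hd : 0 < ‖u - v‖ := norm_pos_iff.2 (sub_ne_zero.2 huv)
  have hBr : 0 < radialCorr α L r := radialCorr_pos hξ.slowlyVarying hr0.le
  have hBpq : 0 < radialCorr α L ‖p - q‖ := radialCorr_pos hξ.slowlyVarying (norm_nonneg _)
  have h1 : r * ‖u - v‖ ≤ ‖p - q‖ + 2 * n := by
    have e : r • (u - v) = (r • u - p) + (p - q) + (q - r • v) := by rw [smul_sub]; abel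
    have h2 := norm_add₃_le (a := r • u - p) (b := p - q) (c := q - r • v)
    rw [← e, norm_smul, Real.norm_of_nonneg hr0.le] at h2
    rw [norm_sub_rev] at hq
    linarith
  have h2 : r / (‖p - q‖ + 1) ≤ (2 * n + 1) * ‖u - v‖⁻¹ := by
    rw [← div_eq_mul_inv, div_le_div_iff₀ (by positivity) hd]
    nlinarith [norm_nonneg (p - q)]
  have h3 : radialCorr α L ‖p - q‖ / radialCorr α L r
      ≤ C * ((2 * n + 1) ^ (α + ε) * ‖u - v‖ ^ (-(α + ε))) := by
    rw [div_le_iff₀ hBr]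
    calc radialCorr α L ‖p - q‖
        ≤ C * radialCorr α L r * (r / (‖p - q‖ + 1)) ^ (α + ε) :=
          hbound r hr _ (norm_nonneg _) hpq
      _ ≤ C * radialCorr α L r * ((2 * n + 1) * ‖u - v‖⁻¹) ^ (α + ε) := by gcongr
      _ = _ := by
          rw [Real.mul_rpow (by positivity) (by positivity), Real.inv_rpow hd.le,
            ← Real.rpow_neg hd.le]
          ring
  rw [← div_pow]
  refine (pow_le_pow_left₀ (by positivity) h3 m).trans_eq ?_
  rw [mul_pow, mul_pow, ← Real.rpow_mul_natCast hd.le, neg_mul, mul_assoc]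

end Limits

/-! ### The limit of the second moment -/

section Main

variable {n : ℕ} {Ω : Type*} [MeasurableSpace Ω] {P : Measure Ω} [IsProbabilityMeasure P]
  {ξ : EuclideanSpace ℝ (Fin n) → Ω → ℝ} {α : ℝ} {L : ℝ → ℝ}
  {g : EuclideanSpace ℝ (Fin n) → ℝ} {m : ℕ}

lemma ae_forall_coord_ne (a : Fin n → ℝ) :
    ∀ᵐ u : EuclideanSpace ℝ (Fin n), ∀ i, u i ≠ a i := by
  refine ae_all_iff.2 fun i => ?_
  have h : ∀ᵐ x : Fin n → ℝ, x i ≠ a i :=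
    Measure.ae_eval_ne (α := fun _ : Fin n => ℝ) (fun _ => volume) i (a i)
  exact (PiLp.volume_preserving_ofLp (Fin n)).quasiMeasurePreserving.ae h

lemma ae_prod_fst_ne_snd (hn : 1 ≤ n) (μ : Measure (EuclideanSpace ℝ (Fin n))) [SFinite μ]
    (hμ : μ ≪ volume) : ∀ᵐ q ∂μ.prod μ, q.1 ≠ q.2 := by
  have : Nonempty (Fin n) := ⟨⟨0, hn⟩⟩
  have hmeas : MeasurableSet
      {q : EuclideanSpace ℝ (Fin n) × EuclideanSpace ℝ (Fin n) | q.1 ≠ q.2} :=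
    (measurableSet_eq_fun measurable_fst measurable_snd).compl
  refine (Measure.ae_prod_iff_ae_ae hmeas).2 (.of_forall fun u => hμ.ae_le ?_)
  filter_upwards [compl_mem_ae_iff.2 (measure_singleton (μ := volume) u)] with v hv h
  exact hv h.symm

/-- The double integral of the normalized covariance kernel vanishes in the limit: its four terms
have the same limit almost everywhere and cancel, and they are dominated by a singular kernel of
order less than `n`. -/
lemma IsLongRangeGaussianField.tendsto_integral_covKernel
    (hξ : IsLongRangeGaussianField P ξ α L) (hn : 1 ≤ n) (hm : 1 ≤ m) (hα : 0 < α)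
    (hαm : α < (n : ℝ) / m) (hg : IsAdmissibleWeight g m α L)
    (hgR : IsRiemannIntegrableOnCubes g) {ι : Type*} {l : Filter ι} [l.IsCountablyGenerated]
    {T : ι → Fin n → ℝ} {τ : ι → ℝ} {a : Fin n → ℝ} (hτ : Tendsto τ l atTop)
    (hTτ : ∀ s i, T s i ≤ τ s) (hγ : ∀ᶠ s in l, g (diagPoint n (τ s)) ≠ 0)
    (ha : ∀ i, Tendsto (fun s => T s i / τ s) l (𝓝 (a i))) :
    Tendsto (fun s => ∫ q, covKernel m α L (boxWeight g (T s) (τ s)) (stepWeight g (T s) (τ s))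
        (fun u => τ s • u) (fun u => floorPoint (τ s • u)) q / radialCorr α L (τ s) ^ m
          ∂(volume.restrict (originBox fun _ : Fin n => 1)).prod
            (volume.restrict (originBox fun _ : Fin n => 1))) l (𝓝 0) := by
  set Q : Set (EuclideanSpace ℝ (Fin n)) := originBox fun _ : Fin n => 1 with hQ
  have hQm : MeasurableSet Q := measurableSet_originBox _
  have hQf : IsFiniteMeasure (volume.restrict Q) := isFiniteMeasure_restrict_originBox _
  obtain ⟨gstar, hlim⟩ := hg.exists_limit
  obtain ⟨M, hM0, hM⟩ := exists_weight_bound (T := T) hlim hgR hτ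
  obtain ⟨β, hβ, C, hC, X, hX, hker⟩ := hξ.exists_kernel_bound hn hm hα hαm
  have hL := hξ.slowlyVarying
  have hLc := hξ.continuousOn_slowlyVarying hn
  have hgood : ∀ᵐ u ∂volume.restrict Q,
      u ∈ Q ∧ (∀ i, u i ≠ a i) ∧ ContinuousWithinAt gstar Q u := by
    filter_upwards [ae_restrict_mem hQm, ae_restrict_of_ae (ae_forall_coord_ne a),
      hgR.ae_continuousWithinAt_limit hlim] with u h1 h2 h3
    exact ⟨h1, h2, h3⟩
  have hgood1 := (Measure.quasiMeasurePreserving_fst (μ := volume.restrict Q)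
    (ν := volume.restrict Q)).ae hgood
  have hgood2 := (Measure.quasiMeasurePreserving_snd (μ := volume.restrict Q)
    (ν := volume.restrict Q)).ae hgood
  have hne := ae_prod_fst_ne_snd hn (volume.restrict Q)
    Measure.restrict_le_self.absolutelyContinuous
  have hzero : (0 : ℝ) = ∫ _q : EuclideanSpace ℝ (Fin n) × EuclideanSpace ℝ (Fin n), (0 : ℝ)
      ∂(volume.restrict Q).prod (volume.restrict Q) := by simp
  rw [hzero]
  refine tendsto_integral_filter_of_dominated_convergence
    (fun q => 4 * (M ^ 2 * (C * ‖q.1 - q.2‖ ^ (-β)))) ?_ ?_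
    ((((integrable_norm_sub_rpow hn hβ).const_mul C).const_mul _).const_mul 4) ?_
  · filter_upwards [hτ.eventually_gt_atTop 0, hγ] with s hs hγs
    exact ((hξ.integral_functional_sub_sq (m := m) hgR hs (hTτ s) hγs).1.aemeasurable.div_const
      _).aestronglyMeasurable
  · filter_upwards [hM, hτ.eventually_ge_atTop X] with s hs hsX
    have hs0 : 0 < τ s := by linarith
    have hB : 0 < radialCorr α L (τ s) ^ m := pow_pos (radialCorr_pos hL hs0.le) m
    filter_upwards [hgood1, hgood2, hne] with q h1 h2 hne
    rw [norm_div, Real.norm_eq_abs, Real.norm_of_nonneg hB.le, div_le_iff₀ hB]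
    have hmem : ∀ u ∈ Q, ∀ x ∈ ({τ s • u, floorPoint (τ s • u)} : Set (EuclideanSpace ℝ (Fin n))),
        ‖τ s • u - x‖ ≤ n ∧ x ∈ originBox fun _ : Fin n => τ s := by
      intro u hu x hx
      have hu' : τ s • u ∈ originBox fun _ : Fin n => τ s := by
        simpa using smul_mem_originBox hs0.le hu
      rcases hx with rfl | rfl
      · exact ⟨by simp, hu'⟩
      · exact ⟨norm_smul_sub_floorPoint_le hs0.le hu, floorPoint_mem_originBox hu'⟩
    refine (abs_covKernel_le (hs _ h1.1).1 (hs _ h2.1).1 (hs _ h1.1).2 (hs _ h2.1).2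
      (K := C * ‖q.1 - q.2‖ ^ (-β) * radialCorr α L (τ s) ^ m) fun x hx y hy => ?_).trans_eq
        (by ring)
    obtain ⟨hx1, hx2⟩ := hmem _ h1.1 x hx
    obtain ⟨hy1, hy2⟩ := hmem _ h2.1 y hy
    rw [abs_of_nonneg (pow_nonneg (radialCorr_pos hL (norm_nonneg _)).le _), ← div_le_iff₀ hB]
    exact hker _ hsX _ _ x y hne hx1 hy1 (norm_sub_le_of_mem_originBox hs0.le hx2 hy2)
  · filter_upwards [hgood1, hgood2, hne] with q h1 h2 hne
    have hA1 := tendsto_boxWeight hlim hτ ha h1.1 h1.2.1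
    have hA2 := tendsto_boxWeight hlim hτ ha h2.1 h2.2.1
    have hS1 := tendsto_stepWeight hlim hτ ha h1.1 h1.2.1 h1.2.2
    have hS2 := tendsto_stepWeight hlim hτ ha h2.1 h2.2.1 h2.2.2
    have hid : ∀ u : EuclideanSpace ℝ (Fin n), Tendsto (fun s => (τ s)⁻¹ • (τ s • u)) l (𝓝 u) := by
      intro u
      refine tendsto_const_nhds.congr' ?_
      filter_upwards [hτ.eventually_gt_atTop 0] with s hs
      rw [inv_smul_smul₀ hs.ne']
    have hf1 := (tendsto_inv_smul_floorPoint hτ h1.1).mono_right nhdsWithin_le_nhds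
    have hf2 := (tendsto_inv_smul_floorPoint hτ h2.1).mono_right nhdsWithin_le_nhds
    have k1 := (hA1.mul hA2).mul
      (tendsto_radialCorr_norm_sub (α := α) hL hLc hτ (hid q.1) (hid q.2) hne m)
    have k2 := (hA1.mul hS2).mul
      (tendsto_radialCorr_norm_sub (α := α) hL hLc hτ (hid q.1) hf2 hne m)
    have k3 := (hS1.mul hA2).mul
      (tendsto_radialCorr_norm_sub (α := α) hL hLc hτ hf1 (hid q.2) hne m)
    have k4 := (hS1.mul hS2).mul
      (tendsto_radialCorr_norm_sub (α := α) hL hLc hτ hf1 hf2 hne m)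
    have k := ((k1.sub k2).sub k3).add k4
    rw [sub_self, zero_sub, neg_add_cancel] at k
    refine k.congr fun s => ?_
    unfold covKernel
    ring

/-- The asymptotic statement along a countably generated filter. -/
lemma IsLongRangeGaussianField.tendsto_functional_sub_sq_div
    (hξ : IsLongRangeGaussianField P ξ α L) (hn : 1 ≤ n) (hm : 1 ≤ m) (hα : 0 < α)
    (hαm : α < (n : ℝ) / m) (hg : IsAdmissibleWeight g m α L)
    (hgR : IsRiemannIntegrableOnCubes g) {ι : Type*} {l : Filter ι} [l.IsCountablyGenerated]
    {T : ι → Fin n → ℝ} {τ : ι → ℝ} {a : Fin n → ℝ} (hτ : Tendsto τ l atTop)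
    (hTτ : ∀ s i, T s i ≤ τ s) (ha : ∀ i, Tendsto (fun s => T s i / τ s) l (𝓝 (a i))) :
    Tendsto (fun s => (∫ ω, (integralFunctional g m ξ (T s) ω
          - additiveFunctional g m ξ (T s) ω) ^ 2 ∂P) /
        (τ s ^ (2 * (n : ℝ) - α * m) * g (diagPoint n (τ s)) ^ 2 * L (τ s) ^ m)) l (𝓝 0) := by
  have hγ : ∀ᶠ s in l, g (diagPoint n (τ s)) ≠ 0 := by
    filter_upwards [(hg.normalization.comp hτ).eventually_gt_atTop 0] with s hs h
    simp [h] at hs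
  have h := (hξ.tendsto_integral_covKernel hn hm hα hαm hg hgR hτ hTτ hγ ha).const_mul
    (m.factorial : ℝ)
  rw [mul_zero] at h
  refine h.congr' ?_
  filter_upwards [hτ.eventually_gt_atTop 0, hγ] with s hs hγs
  have hL := hξ.slowlyVarying.pos _ hs
  rw [(hξ.integral_functional_sub_sq (m := m) hgR hs (hTτ s) hγs).2, integral_div]
  have e : τ s ^ (2 * (n : ℝ) - α * m) * g (diagPoint n (τ s)) ^ 2 * L (τ s) ^ m
      = (τ s ^ n * g (diagPoint n (τ s))) ^ 2 * radialCorr α L (τ s) ^ m := by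
    rw [radialCorr_of_pos hs, mul_pow, mul_pow, sub_eq_add_neg, Real.rpow_add hs,
      ← Real.rpow_mul_natCast hs.le, neg_mul, mul_comm (2 : ℝ), Real.rpow_mul hs.le,
      Real.rpow_natCast, Real.rpow_two]
    ring
  rw [e, mul_div_mul_left _ _ (by positivity), mul_div_assoc]

end Main

theorem theorem4 {Ω : Type*} [MeasurableSpace Ω] (P : Measure Ω) [IsProbabilityMeasure P]
    (n m : ℕ) (hn : 1 ≤ n) (hm : 1 ≤ m) (α : ℝ) (hα : 0 < α) (hαm : α < (n : ℝ) / (m : ℝ))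
    (L : ℝ → ℝ) (ξ : EuclideanSpace ℝ (Fin n) → Ω → ℝ)
    (hξ : IsLongRangeGaussianField P ξ α L)
    (g : EuclideanSpace ℝ (Fin n) → ℝ) (hg : IsAdmissibleWeight g m α L)
    (hgR : IsRiemannIntegrableOnCubes g) :
    (∀ T : Fin n → ℝ,
      (∀ᵐ ω ∂P, IntegrableOn (fun t => g t * hermiteFun m (ξ t ω)) (originBox T)) ∧
      MemLp (fun ω => integralFunctional g m ξ T ω - additiveFunctional g m ξ T ω) 2 P) ∧
    ∀ {ι : Type*} (l : Filter ι) (T : ι → Fin n → ℝ),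
      (∀ s i, 0 ≤ T s i) →
      Tendsto (fun s => ⨆ i, T s i) l atTop →
      (∀ i, ∃ a : ℝ, Tendsto (fun s => T s i / ⨆ j, T s j) l (𝓝 a)) →
      Tendsto
        (fun s => (∫ ω, (integralFunctional g m ξ (T s) ω
              - additiveFunctional g m ξ (T s) ω) ^ 2 ∂P) /
          ((⨆ i, T s i) ^ (2 * (n : ℝ) - α * m) * g (diagPoint n (⨆ i, T s i)) ^ 2
            * L (⨆ i, T s i) ^ m))
        l (𝓝 0) := by
  refine ⟨fun T => ⟨hξ.ae_integrableOn hgR T,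
    (hξ.memLp_integralFunctional hgR T).sub (hξ.memLp_additiveFunctional g T)⟩, ?_⟩
  intro ι l T _ hτ ha
  choose a ha using ha
  -- Dominated convergence needs a countably generated filter, so the limit is first taken along the
  -- coarsest filter on the side lengths satisfying the hypotheses.
  let F : Filter (Fin n → ℝ) := comap (fun t => ⨆ i, t i) atTop ⊓
    ⨅ i, comap (fun t => t i / ⨆ j, t j) (𝓝 (a i))
  have hF : Tendsto T l F := tendsto_inf.2 ⟨tendsto_comap_iff.2 hτ,
    tendsto_iInf.2 fun i => tendsto_comap_iff.2 (ha i)⟩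
  exact (hξ.tendsto_functional_sub_sq_div (l := F) (T := id) hn hm hα hαm hg hgR
    (tendsto_comap.mono_left inf_le_left)
    (fun t i => le_ciSup (f := t) (Set.finite_range t).bddAbove i)
    fun i => tendsto_comap.mono_left (inf_le_right.trans (iInf_le _ i))).comp hF
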